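/- Let $K$ be the two-variable Kauffman polynomial of unoriented link diagrams in the plane, with values in $\mathbb{Z}[a^{\pm1},z^{\pm1}]$. It is the regular isotopy invariant defined by $K(L_+)+K(L_-)=z\,(K(L_a)+K(L_b))$ (where $L_a,L_b$ are the two smoothings of the crossing), by $K(L_{pos})=a^{-1}K(L)$ and $K(L_{neg})=aK(L)$ for diagrams $L_{pos}$, $L_{neg}$ obtained from $L$ by adding a positive, respectively negative, kink, by $K(L\sqcup O)=\left(\frac{a+a^{-1}}{z}-1\right)K(L)$, and by $K(O)=1$ for the crossingless unknot diagram $O$. Let $K(2,q)$ denote its value on the $(2,q)$ torus link diagram, the closure of the two-strand braid $\sigma_1^q$, all of whose crossings are positive. The balanced overlaid Tait graph of this diagram ($q\ge 1$) is the bipartite graph whose vertices are, on one side, the $q$ crossings and, on the other side, the faces of the diagram except for two omitted faces: the inner unshaded face and the shaded face to the right of it, which touch along a strand (faces are checkerboard coloured, the outside face being unshaded). A crossing and a face are adjacent if they touch. Order the crossings from top to bottom. An edge at a shaded face has the letter $L$ if its crossing is the first one at that face and $D$ otherwise; an edge at an unshaded face has the letter $\ell$ if its crossing is the first one at that face and $d$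 otherwise. Let $P_q\in\mathbb{Z}[L,\ell,D,d]$ be the sum over all perfect matchings of the products of the letters of their edges, specialized via $L=a=\ell^{-1}$ and $D=d=z$, and put $P_0=\frac{a+a^{-1}}{z}-1$. Let $g_0=1$, $g_1=z$ and $g_n=z\,g_{n-1}-g_{n-2}$. Theorem. For all $q\ge 2$, $$K(2,q)=P_q-\sum_{i=0}^{q-2}P_i\,g_{q-2-i}.$$ More precisely, this identity follows from the defining relations: in the skein module of link diagrams over $\mathbb{Z}[a^{\pm1},z^{\pm1}]$ modulo the relations for $K$, the class of the $(2,q)$ torus link diagram is the right-hand side times the class of $O$, and every $\mathbb{Z}[a^{\pm1},z^{\pm1}]$-valued function on diagrams that satisfies the relations and takes the value $1$ on $O$ has the right-hand side as its value. For every $q\ge1$ the unspecialized sum over perfect matchings is the determinant of the $q\times q$ crossing-by-face matrix of edge letters (with $0$ for non-adjacent pairs), after a suitable choice of signs of the entries and of an ordering of the faces. Moreover, there is an algorithm which computes all coefficients of $K(2,q)$ from the number $q\geq 2$ of crossings in a number of steps that is polynomial in $q$ (on a random access machine with integer memory cells whose only arithmetic operations are addition and subtraction). -/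

import Mathlib

namespace KauffmanTorus

/-! ### Link diagrams -/

/-- Elementary pieces of a link diagram cut by horizontal lines and read from top to bottom.
`birth` is a local maximum, `death` is a local minimum, and `cross true` (resp. `cross false`) is a
crossing of two neighbouring strands which is positive (resp. negative) when both strands are
oriented downwards (in `cross true` the strand running from top right to bottom left is over). -/
inductive Kind where
  | birth : Kind
  | death : Kind
  | cross : Bool → Kind
  deriving DecidableEq

/-- Number of strands entering an elementary piece from above. -/
def Kind.top : Kind → ℕ
  | .birth => 0
  | .death => 2
  | .cross _ => 2

/-- Number of strands leaving an elementary piece below. -/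
def Kind.bot : Kind → ℕ
  | .birth => 2
  | .death => 0
  | .cross _ => 2

/-- A horizontal slice of a diagram: an elementary piece that has exactly `pos` strands on its
left; all other strands run straight down. -/
structure Slice where
  kind : Kind
  pos : ℕ
  deriving DecidableEq

abbrev birth (i : ℕ) : Slice := ⟨.birth, i⟩
abbrev death (i : ℕ) : Slice := ⟨.death, i⟩
abbrev cross (ε : Bool) (i : ℕ) : Slice := ⟨.cross ε, i⟩

/-- The number of strands below a list of slices which has `n` strands above it. -/
def width : ℕ → List Slice → ℕ
  | n, [] => n
  | n, s :: w => width (n - s.kind.top + s.kind.bot) w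

/-- The slices fit together, starting with `n` strands above and ending with no strand. -/
def Closes : ℕ → List Slice → Prop
  | n, [] => n = 0
  | n, s :: w => s.pos + s.kind.top ≤ n ∧ Closes (n - s.kind.top + s.kind.bot) w

/-- A (non-empty, unoriented) link diagram in the plane, presented by its slices. -/
structure LinkDiagram where
  word : List Slice
  ne_nil : word ≠ []
  closes : Closes 0 word

/-- The crossingless diagram `O` of the unknot. -/
def unknot : LinkDiagram where
  word := [birth 0, death 0]
  ne_nil := by simp
  closes := by simp [Closes, Kind.top, Kind.bot]

theorem closes_replicate (q : ℕ) (w : List Slice) (h : Closes 4 w) :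
    Closes 4 (List.replicate q (cross true 0) ++ w) := by
  induction q with
  | zero => simpa using h
  | succ q ih => simpa [List.replicate_succ, Closes, Kind.top, Kind.bot] using ih

/-- The `(2,q)` torus link: the closure on the right of the braid `σ₁ ^ q` on two strands. -/
def torusLink (q : ℕ) : LinkDiagram where
  word := [birth 0, birth 1] ++ (List.replicate q (cross true 0) ++ [death 1, death 0])
  ne_nil := by simp
  closes := by
    have h := closes_replicate q [death 1, death 0] (by simp [Closes, Kind.top, Kind.bot])
    simpa [Closes, Kind.top, Kind.bot] using h

/-! ### The Kauffman polynomial -/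

/-- Laurent polynomials in two variables `a`, `z` with integer coefficients. -/
abbrev Laurent : Type := AddMonoidAlgebra ℤ (ℤ × ℤ)

/-- The monomial `a ^ i * z ^ j`. -/
noncomputable def mono (i j : ℤ) : Laurent := AddMonoidAlgebra.single (i, j) 1

/-- The factor `(a + a⁻¹) / z - 1` of a split unknotted circle. -/
noncomputable def delta : Laurent := (mono 1 0 + mono (-1) 0) * mono 0 (-1) - 1

/-- Local moves generating regular isotopy of diagrams cut into slices: planar isotopies, and the
second and third Reidemeister moves (not the first). -/
inductive Move : List Slice → List Slice → Prop
  /-- Pieces side by side exchange their heights. -/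
  | exchange (k l : Kind) (i d : ℕ) :
      Move [⟨k, i⟩, ⟨l, i + k.bot + d⟩] [⟨l, i + k.top + d⟩, ⟨k, i⟩]
  /-- A maximum and a minimum next to each other on a strand cancel. -/
  | zigzag_left (i : ℕ) : Move [birth i, death (i + 1)] []
  | zigzag_right (i : ℕ) : Move [birth (i + 1), death i] []
  /-- A maximum, or a minimum, moves along its strand past a crossing, which is turned. -/
  | turn_birth (ε : Bool) (i : ℕ) :
      Move [birth i, cross ε (i + 1)] [birth (i + 1), cross (!ε) i]
  | turn_death (ε : Bool) (i : ℕ) :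
      Move [cross ε (i + 1), death i] [cross (!ε) i, death (i + 1)]
  | reidemeister_two (ε : Bool) (i : ℕ) : Move [cross ε i, cross (!ε) i] []
  | reidemeister_three (ε : Bool) (i : ℕ) :
      Move [cross ε i, cross ε (i + 1), cross ε i]
        [cross ε (i + 1), cross ε i, cross ε (i + 1)]

/-- `Kink ε x y`: the piece `x` is the piece `y` with one kink added to a strand; the kink is
positive if `ε = true` and negative if `ε = false`. In the first two pictures both passages through
the crossing run downwards, so the sign of the kink is that of the slice; in the last two one
passage runs upwards, so the sign is opposite. -/
inductive Kink : Bool → List Slice → List Slice → Prop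
  | right (ε : Bool) (i : ℕ) : Kink ε [birth (i + 1), cross ε i, death (i + 1)] []
  | left (ε : Bool) (i : ℕ) : Kink ε [birth i, cross ε (i + 1), death i] []
  | up (ε : Bool) (i : ℕ) : Kink ε [birth i, cross (!ε) i] [birth i]
  | down (ε : Bool) (i : ℕ) : Kink ε [cross (!ε) i, death i] [death i]

/-- Formal linear combinations of diagrams. -/
abbrev Chains : Type := LinkDiagram →₀ Laurent

/-- A diagram as a formal linear combination. -/
noncomputable abbrev chain (D : LinkDiagram) : Chains := Finsupp.single D 1

/-- `At u x v D`: the diagram `D` is `x` with `u` above and `v` below it. -/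
def At (u x v : List Slice) (D : LinkDiagram) : Prop := D.word = u ++ x ++ v

/-- The defining relations of `K`, as combinations of diagrams that have to vanish:
regular isotopy invariance, the skein relation `L₊ + L₋ = z (L_a + L_b)`, the factor `a⁻¹` for a
positive and `a` for a negative kink, and the factor `(a + a⁻¹) / z - 1` for a split circle. -/
inductive Relator : Chains → Prop
  | isotopy {u v x y : List Slice} {D D' : LinkDiagram} (hm : Move x y)
      (h : At u x v D) (h' : At u y v D') : Relator (chain D - chain D')
  | skein {u v : List Slice} (i : ℕ) {Dp Dm Da Db : LinkDiagram}
      (hp : At u [cross true i] v Dp) (hm : At u [cross false i] v Dm)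
      (ha : At u [] v Da) (hb : At u [death i, birth i] v Db) :
      Relator (chain Dp + chain Dm - mono 0 1 • (chain Da + chain Db))
  | pos_kink {u v x y : List Slice} {D D' : LinkDiagram} (hk : Kink true x y)
      (h : At u x v D) (h' : At u y v D') : Relator (chain D - mono (-1) 0 • chain D')
  | neg_kink {u v x y : List Slice} {D D' : LinkDiagram} (hk : Kink false x y)
      (h : At u x v D) (h' : At u y v D') : Relator (chain D - mono 1 0 • chain D')
  | circle {u v : List Slice} (i : ℕ) {D D' : LinkDiagram}
      (h : At u [birth i, death i] v D) (h' : At u [] v D') :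
      Relator (chain D - delta • chain D')

/-- The Kauffman skein module of the plane: combinations of link diagrams modulo the defining
relations of `K`. -/
abbrev Skein : Type := Chains ⧸ Submodule.span Laurent {x : Chains | Relator x}

/-- The value `K(D)` of the universal solution of the defining relations. The normalisation
`K(O) = 1` identifies a Laurent polynomial `r` with `r • K unknot`. -/
noncomputable def K (D : LinkDiagram) : Skein :=
  (Submodule.span Laurent {x : Chains | Relator x}).mkQ (chain D)

/-- `F` is a Laurent polynomial valued function on diagrams that satisfies the defining relations
and the normalisation `F(O) = 1`. -/
def IsKauffmanPolynomial (F : LinkDiagram → Laurent) : Prop :=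
  F unknot = 1 ∧ ∀ x, Relator x → Finsupp.linearCombination Laurent F x = 0

/-! ### The balanced overlaid Tait graph -/

/-- The number of strands at height `t`, that is, below the first `t` slices. -/
def strandsAt (w : List Slice) (t : ℕ) : ℕ := width 0 (w.take t)

/-- An interval between neighbouring strands on the horizontal line at some height; interval
number `g` has `g` strands on its left. -/
abbrev Gap (w : List Slice) : Type :=
  Σ t : Fin (w.length + 1), Fin (strandsAt w t + 1)

/-- The intervals `c`, `c'` above and below one slice lie in the same region of that slice. -/
def SameRegion (w : List Slice) (c c' : Gap w) : Prop :=
  ∃ s : Slice, w[(c.1 : ℕ)]? = some s ∧ (c'.1 : ℕ) = c.1 + 1 ∧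
    (((c.2 : ℕ) ≤ s.pos ∧ (c'.2 : ℕ) = c.2) ∨
      ∃ d : ℕ, (c.2 : ℕ) = s.pos + s.kind.top + d ∧ (c'.2 : ℕ) = s.pos + s.kind.bot + d)

/-- The faces of a diagram: intervals glued along the regions of all slices. -/
abbrev Face (w : List Slice) : Type := Quot (SameRegion w)

theorem SameRegion.odd_iff {w : List Slice} {c c' : Gap w} (h : SameRegion w c c') :
    Odd (c.2 : ℕ) ↔ Odd (c'.2 : ℕ) := by
  obtain ⟨⟨k, i⟩, -, -, ⟨-, h⟩ | ⟨d, h, h'⟩⟩ := h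
  · rw [h]
  · rw [h, h']
    cases k <;> simp [Kind.top, Kind.bot, parity_simps]

/-- The checkerboard colouring in which the outside face is not shaded. -/
def Shaded {w : List Slice} : Face w → Prop :=
  Quot.lift (fun c => Odd (c.2 : ℕ)) fun _ _ h => propext h.odd_iff

/-- The crossings of a diagram, ordered from top to bottom. -/
abbrev Crossing (w : List Slice) : Type :=
  {t : Fin w.length // ∃ ε, (w.get t).kind = .cross ε}

/-- The face `f` is one of the four corners at the crossing `v`. -/
def Touches {w : List Slice} (v : Crossing w) (f : Face w) : Prop :=
  ∃ c : Gap w, Quot.mk _ c = f ∧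
    (((c.1 : ℕ) = v.1 ∧ ((c.2 : ℕ) = (w.get v.1).pos ∨ (c.2 : ℕ) = (w.get v.1).pos + 1 ∨
        (c.2 : ℕ) = (w.get v.1).pos + 2)) ∨
      ((c.1 : ℕ) = v.1 + 1 ∧ (c.2 : ℕ) = (w.get v.1).pos + 1))

/-- The face `f` is one of the two faces that touch along the strand which has `g` strands on its
left at height `t`. -/
def Beside {w : List Slice} (t g : ℕ) (f : Face w) : Prop :=
  ∃ c : Gap w, Quot.mk _ c = f ∧ (c.1 : ℕ) = t ∧ ((c.2 : ℕ) = g ∨ (c.2 : ℕ) = g + 1)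

/-- The second vertex class of the balanced overlaid Tait graph (the first one is `Crossing w`):
all faces but the two that touch along the chosen strand. A crossing and a face are adjacent if they
touch. -/
abbrev TaitFace (w : List Slice) (t g : ℕ) : Type := {f : Face w // ¬ Beside t g f}

noncomputable instance (w : List Slice) (t g : ℕ) : Fintype (TaitFace w t g) :=
  Fintype.ofFinite _

/-- Activity letters of positive crossings. -/
inductive Letter where
  | L : Letter
  | ell : Letter
  | D : Letter
  | d : Letter
  deriving DecidableEq

open Classical in
/-- The activity letter of the edge between `v` and `f` of the balanced overlaid Tait graph of a
diagram all of whose crossings are positive (so that no barred letters occur). -/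
noncomputable def letter {w : List Slice} (v : Crossing w) (f : Face w) : Letter :=
  if ∀ v' : Crossing w, Touches v' f → v ≤ v' then
    if Shaded f then .L else .ell
  else
    if Shaded f then .D else .d

/-- A set of edges of the balanced overlaid Tait graph that covers every vertex exactly once. -/
def IsPerfectMatching {w : List Slice} {t g : ℕ} (M : Finset (Crossing w × TaitFace w t g)) :
    Prop :=
  (∀ e ∈ M, Touches e.1 e.2.1) ∧ (∀ v, ∃! f, (v, f) ∈ M) ∧ (∀ f, ∃! v, (v, f) ∈ M)

open Classical in
/-- The sum of the activity words of all perfect matchings. -/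
noncomputable def matchingPolynomial (w : List Slice) (t g : ℕ) : MvPolynomial Letter ℤ :=
  ∑ M : Finset (Crossing w × TaitFace w t g) with IsPerfectMatching M,
    ∏ e ∈ M, MvPolynomial.X (letter e.1 e.2.1)

open Classical in
/-- The modified adjacency matrix: activity letters at the edges, zero elsewhere. -/
noncomputable def adjacencyMatrix (w : List Slice) (t g : ℕ) :
    Matrix (Crossing w) (TaitFace w t g) (MvPolynomial Letter ℤ) :=
  fun v f => if Touches v f.1 then MvPolynomial.X (letter v f.1) else 0

/-- The specialisation `L = a`, `ℓ = a⁻¹`, `D = d = z`. -/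
noncomputable def specialize : Letter → Laurent
  | .L => mono 1 0
  | .ell => mono (-1) 0
  | .D => mono 0 1
  | .d => mono 0 1

/-- `P_0 = (a + a⁻¹) / z - 1`, and for `q ≥ 1` the specialised sum of activity words of the perfect
matchings of the balanced overlaid Tait graph of the `(2,q)` torus link. The two omitted faces are
the two rightmost bounded ones: those touching along the third of the four strands below the two
maxima. -/
noncomputable def P : ℕ → Laurent
  | 0 => delta
  | q + 1 => MvPolynomial.aeval specialize (matchingPolynomial (torusLink (q + 1)).word 2 2)

/-- `g_0 = 1`, `g_1 = z`, `g_n = z g_{n-1} - g_{n-2}`. -/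
noncomputable def g : ℕ → Laurent
  | 0 => 1
  | 1 => mono 0 1
  | n + 2 => mono 0 1 * g (n + 1) - g n

/-! ### Computation in polynomial time -/

/-- Programs of a random access machine whose memory cells hold integers. Additions and
subtractions are the only arithmetic operations, so that after `t` steps all numbers have
`O(t)` bits more than the input, and a count of steps that is polynomial means polynomial time in
the usual sense. -/
inductive Program where
  /-- `mem[x] := c` -/
  | const (x c : ℤ) : Program
  /-- `mem[x] := mem[y] + mem[y']` -/
  | add (x y y' : ℤ) : Program
  /-- `mem[x] := mem[y] - mem[y']` -/
  | sub (x y y' : ℤ) : Program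
  /-- `mem[x] := mem[mem[y]]` -/
  | load (x y : ℤ) : Program
  /-- `mem[mem[x]] := mem[y]` -/
  | store (x y : ℤ) : Program
  | seq (p p' : Program) : Program
  /-- if `mem[x] > 0` then `p` else `p'` -/
  | ifPos (x : ℤ) (p p' : Program) : Program
  /-- while `mem[x] > 0` do `p` -/
  | whilePos (x : ℤ) (p : Program) : Program

/-- `Runs p m m' t`: the program `p`, started with memory `m`, halts after `t` steps with memory
`m'`. Every assignment and every test is one step. -/
inductive Runs : Program → (ℤ → ℤ) → (ℤ → ℤ) → ℕ → Prop
  | const (x c : ℤ) (m : ℤ → ℤ) : Runs (.const x c) m (Function.update m x c) 1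
  | add (x y y' : ℤ) (m : ℤ → ℤ) : Runs (.add x y y') m (Function.update m x (m y + m y')) 1
  | sub (x y y' : ℤ) (m : ℤ → ℤ) : Runs (.sub x y y') m (Function.update m x (m y - m y')) 1
  | load (x y : ℤ) (m : ℤ → ℤ) : Runs (.load x y) m (Function.update m x (m (m y))) 1
  | store (x y : ℤ) (m : ℤ → ℤ) : Runs (.store x y) m (Function.update m (m x) (m y)) 1
  | seq {p p' : Program} {m m' m'' : ℤ → ℤ} {t t' : ℕ} (h : Runs p m m' t)
      (h' : Runs p' m' m'' t') : Runs (.seq p p') m m'' (t + t')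
  | ifPos_true {x : ℤ} {p p' : Program} {m m' : ℤ → ℤ} {t : ℕ} (hx : 0 < m x)
      (h : Runs p m m' t) : Runs (.ifPos x p p') m m' (t + 1)
  | ifPos_false {x : ℤ} {p p' : Program} {m m' : ℤ → ℤ} {t : ℕ} (hx : m x ≤ 0)
      (h : Runs p' m m' t) : Runs (.ifPos x p p') m m' (t + 1)
  | while_true {x : ℤ} {p : Program} {m m' m'' : ℤ → ℤ} {t t' : ℕ} (hx : 0 < m x)
      (h : Runs p m m' t) (h' : Runs (.whilePos x p) m' m'' t') :
      Runs (.whilePos x p) m m'' (t + t' + 1)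
  | while_false {x : ℤ} {p : Program} {m : ℤ → ℤ} (hx : m x ≤ 0) : Runs (.whilePos x p) m m 1

/-- The initial memory: the number `q` of crossings in cell `0`, zero elsewhere. -/
def input (q : ℕ) : ℤ → ℤ := Function.update 0 0 (q : ℤ)

/-- The Laurent polynomial `∑ c_{ij} a ^ (i - 1) z ^ (j - 1)`, `0 ≤ i, j ≤ q`, whose coefficients
are stored row by row in the cells `0, …, (q + 1) ^ 2 - 1`. -/
noncomputable def output (q : ℕ) (m : ℤ → ℤ) : Laurent :=
  ∑ i ∈ Finset.range (q + 1), ∑ j ∈ Finset.range (q + 1),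
    m ((i : ℤ) * (q + 1) + j) • mono ((i : ℤ) - 1) ((j : ℤ) - 1)

end KauffmanTorus

open KauffmanTorus

/-!
Resolving the last crossing of the `(2, q + 2)` torus link gives the `(2, q + 1)` torus link, a link
with a clasp that a second Reidemeister move turns into the `(2, q)` torus link, and an unknot with
`q + 1` negative kinks. Hence the coefficient `t_q` of `K unknot` obeys the three-term recursion
`t_{q+2} = z t_{q+1} - t_q + z a ^ (q + 1)`.

Listing the crossings from top to bottom and the faces with the outside face first and then the
bigons between consecutive crossings, the adjacency matrix of the balanced overlaid Tait graph has
entries only in the first column, on the diagonal and on the first superdiagonal. A perfect matching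
is therefore determined by the crossing `k` that is matched with the outside face: the crossings
above `k` are matched with the bigons below them and the others with the bigons above them. Such a
matching is a cycle on an initial segment, so signs in the first column turn the determinant into
the sum over the matchings, and `P_{q+2} = z P_{q+1} + z a ^ (q + 1)`. As `P` and `t` have the same
initial values, `t - P` solves a three-term recursion with the inhomogeneity `-P` and zero initial
values, whose solution is the convolution of `-P` with the fundamental solution `g`.

For the computation, the coefficient arrays of `t_q, …, t_0` are stored one after the other.
Multiplication by `z` shifts an array by one cell, so that one loop, which runs once through the
memory, carries out the whole recursion with additions and subtractions at fixed distances.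
-/

namespace KauffmanTorus

/-! ### The skein recursion -/

theorem mono_mul_mono (i j k l : ℤ) : mono i j * mono k l = mono (i + k) (j + l) := by
  simp [mono, AddMonoidAlgebra.single_mul_single]

theorem mono_zero : mono 0 0 = 1 := rfl

theorem mkQ_eq_zero {x : Chains} (h : Relator x) :
    (Submodule.span Laurent {x : Chains | Relator x}).mkQ x = 0 := by
  rw [Submodule.mkQ_apply, Submodule.Quotient.mk_eq_zero]
  exact Submodule.subset_span h

theorem K_isotopy {u v x y : List Slice} {D D' : LinkDiagram} (hm : Move x y)
    (h : At u x v D) (h' : At u y v D') : K D = K D' := by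
  have := mkQ_eq_zero (Relator.isotopy hm h h')
  rwa [map_sub, sub_eq_zero] at this

theorem K_skein {u v : List Slice} (i : ℕ) {Dp Dm Da Db : LinkDiagram}
    (hp : At u [cross true i] v Dp) (hm : At u [cross false i] v Dm)
    (ha : At u [] v Da) (hb : At u [death i, birth i] v Db) :
    K Dp = mono 0 1 • (K Da + K Db) - K Dm := by
  have := mkQ_eq_zero (Relator.skein i hp hm ha hb)
  rw [map_sub, map_add, map_smul, map_add, sub_eq_zero] at this
  exact eq_sub_of_add_eq this

theorem K_pos_kink {u v x y : List Slice} {D D' : LinkDiagram} (hk : Kink true x y)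
    (h : At u x v D) (h' : At u y v D') : K D = mono (-1) 0 • K D' := by
  have := mkQ_eq_zero (Relator.pos_kink hk h h')
  rwa [map_sub, map_smul, sub_eq_zero] at this

theorem K_neg_kink {u v x y : List Slice} {D D' : LinkDiagram} (hk : Kink false x y)
    (h : At u x v D) (h' : At u y v D') : K D = mono 1 0 • K D' := by
  have := mkQ_eq_zero (Relator.neg_kink hk h h')
  rwa [map_sub, map_smul, sub_eq_zero] at this

theorem K_circle {u v : List Slice} (i : ℕ) {D D' : LinkDiagram}
    (h : At u [birth i, death i] v D) (h' : At u [] v D') : K D = delta • K D' := by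
  have := mkQ_eq_zero (Relator.circle i h h')
  rwa [map_sub, map_smul, sub_eq_zero] at this

theorem IsKauffmanPolynomial.eq_of_K_eq_smul {F : LinkDiagram → Laurent}
    (hF : IsKauffmanPolynomial F) {D : LinkDiagram} {r : Laurent} (h : K D = r • K unknot) :
    F D = r := by
  let φ : Skein →ₗ[Laurent] Laurent :=
    (Submodule.span Laurent {x : Chains | Relator x}).liftQ (Finsupp.linearCombination Laurent F)
      (Submodule.span_le.2 fun x hx => hF.2 x hx)
  have hφ (D : LinkDiagram) : φ (K D) = F D := by
    simp [φ, K, Submodule.liftQ_apply, chain]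
  rw [← hφ, h, map_smul, hφ, hF.1, smul_eq_mul, mul_one]

/-- The closed diagram consisting of two nested maxima, `q` crossings and a bottom part `w`. -/
def capped (q : ℕ) (w : List Slice) (h : Closes 4 w) : LinkDiagram where
  word := [birth 0, birth 1] ++ (List.replicate q (cross true 0) ++ w)
  ne_nil := by simp
  closes := by simpa [Closes, Kind.top, Kind.bot] using closes_replicate q w h

/-- The torus link with a horizontal smoothing below its crossings. -/
def cupped (q : ℕ) : LinkDiagram :=
  capped q [death 0, birth 0, death 1, death 0] (by simp [Closes, Kind.top, Kind.bot])

/-- The torus link with an additional negative crossing. -/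
def clasped (q : ℕ) : LinkDiagram :=
  capped q [cross false 0, death 1, death 0] (by simp [Closes, Kind.top, Kind.bot])

theorem K_clasped (q : ℕ) : K (clasped (q + 1)) = K (torusLink q) :=
  K_isotopy (Move.reidemeister_two true 0)
    (u := [birth 0, birth 1] ++ List.replicate q (cross true 0)) (v := [death 1, death 0])
    (by simp [At, clasped, capped, List.replicate_succ']) (by simp [At, torusLink])

theorem K_cupped_succ (q : ℕ) : K (cupped (q + 1)) = mono 1 0 • K (cupped q) :=
  K_neg_kink (Kink.down false 0)
    (u := [birth 0, birth 1] ++ List.replicate q (cross true 0)) (v := [birth 0, death 1, death 0])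
    (by simp [At, cupped, capped, List.replicate_succ']) (by simp [At, cupped, capped])

theorem K_cupped_zero : K (cupped 0) = K unknot := by
  let D : LinkDiagram := ⟨[birth 0, birth 0, death 1, death 0], by simp,
    by simp [Closes, Kind.top, Kind.bot]⟩
  have h₁ : K (cupped 0) = K D :=
    K_isotopy (Move.zigzag_right 0) (u := [birth 0]) (v := [birth 0, death 1, death 0])
      (by simp [At, cupped, capped]) (by simp [At, D])
  have h₂ : K D = K unknot :=
    K_isotopy (Move.zigzag_left 0) (u := [birth 0]) (v := [death 0])
      (by simp [At, D]) (by simp [At, unknot])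
  rw [h₁, h₂]

theorem K_cupped (q : ℕ) : K (cupped q) = mono q 0 • K unknot := by
  induction q with
  | zero => rw [K_cupped_zero, Nat.cast_zero, mono_zero, one_smul]
  | succ q ih =>
    rw [K_cupped_succ, ih, smul_smul, mono_mul_mono, Nat.cast_succ, add_comm, add_zero]

theorem K_torusLink_zero : K (torusLink 0) = delta • K unknot :=
  K_circle 1 (u := [birth 0]) (v := [death 0]) (by simp [At, torusLink]) (by simp [At, unknot])

theorem K_torusLink_one : K (torusLink 1) = mono (-1) 0 • K unknot :=
  K_pos_kink (Kink.right true 0) (u := [birth 0]) (v := [death 0])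
    (by simp [At, torusLink]) (by simp [At, unknot])

theorem K_torusLink_add_two (q : ℕ) :
    K (torusLink (q + 2)) =
      mono 0 1 • (K (torusLink (q + 1)) + mono (q + 1) 0 • K unknot) - K (torusLink q) := by
  have h := K_skein 0 (u := [birth 0, birth 1] ++ List.replicate (q + 1) (cross true 0))
    (v := [death 1, death 0]) (Dp := torusLink (q + 2)) (Dm := clasped (q + 1))
    (Da := torusLink (q + 1)) (Db := cupped (q + 1))
    (by simp [At, torusLink, List.replicate_succ'])
    (by simp [At, clasped, capped]) (by simp [At, torusLink]) (by simp [At, cupped, capped])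
  rw [h, K_clasped, K_cupped, Nat.cast_succ]

/-- The coefficient of `K unknot` in `K (torusLink q)`. -/
noncomputable def torusPolynomial : ℕ → Laurent
  | 0 => delta
  | 1 => mono (-1) 0
  | q + 2 => mono 0 1 * torusPolynomial (q + 1) - torusPolynomial q + mono (q + 1) 1

theorem K_torusLink (q : ℕ) : K (torusLink q) = torusPolynomial q • K unknot := by
  induction q using torusPolynomial.induct with
  | case1 => exact K_torusLink_zero
  | case2 => exact K_torusLink_one
  | case3 q ih₁ ih₀ =>
    rw [K_torusLink_add_two, ih₁, ih₀, torusPolynomial, add_smul, sub_smul, smul_add, smul_smul,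
      smul_smul, mono_mul_mono, zero_add, add_zero]
    abel

section ThreeTermRecursion

variable {R : Type*} [CommRing R] {z : R} {g : ℕ → R}

theorem sum_range_mul_add_two (g_zero : g 0 = 1) (g_one : g 1 = z)
    (g_add_two : ∀ n, g (n + 2) = z * g (n + 1) - g n) (p : ℕ → R) (n : ℕ) :
    ∑ i ∈ Finset.range (n + 2), p i * g (n + 1 - i) =
      z * ∑ i ∈ Finset.range (n + 1), p i * g (n - i) -
        ∑ i ∈ Finset.range n, p i * g (n - 1 - i) + p (n + 1) := by
  have summand (i : ℕ) (hi : i ∈ Finset.range n) : p i * g (n + 1 - i) =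
      z * (p i * g (n - i)) - p i * g (n - 1 - i) := by
    obtain ⟨k, rfl⟩ := Nat.exists_eq_add_of_lt (Finset.mem_range.1 hi)
    rw [show i + k + 1 + 1 - i = k + 2 by omega, show i + k + 1 - i = k + 1 by omega,
      show i + k + 1 - 1 - i = k by omega, g_add_two]
    ring
  rw [Finset.sum_range_succ, Finset.sum_range_succ, Finset.sum_congr rfl summand,
    Finset.sum_sub_distrib, ← Finset.mul_sum, Finset.sum_range_succ, Nat.add_sub_cancel_left,
    Nat.sub_self, Nat.sub_self, g_zero, g_one]
  ring

/- Subtracting the first-order solution `p` leaves a three-term recursion with inhomogeneity `-p`,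
whose fundamental solution is `g`. -/
theorem eq_sub_sum_of_recursion (g_zero : g 0 = 1) (g_one : g 1 = z)
    (g_add_two : ∀ n, g (n + 2) = z * g (n + 1) - g n) {t p c : ℕ → R}
    (t_zero : t 0 = p 0) (t_one : t 1 = p 1)
    (t_add_two : ∀ n, t (n + 2) = z * t (n + 1) - t n + c n)
    (p_add_two : ∀ n, p (n + 2) = z * p (n + 1) + c n) (n : ℕ) :
    t (n + 1) = p (n + 1) - ∑ i ∈ Finset.range n, p i * g (n - 1 - i) := by
  induction n using Nat.twoStepInduction with
  | zero => simp [t_one]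
  | one => simp [t_add_two, p_add_two, t_zero, t_one, g_zero]; ring
  | more n ih₀ ih₁ =>
    rw [t_add_two, ih₁, ih₀, p_add_two (n + 1), show n + 2 - 1 = n + 1 from rfl,
      sum_range_mul_add_two g_zero g_one g_add_two p n, Nat.add_sub_cancel]
    ring

end ThreeTermRecursion

/-! ### Faces -/

/-- The interval number `i` above the slice `s` and the interval number `i'` below it lie in the
same region of `s`. -/
def Joins (s : Slice) (i i' : ℕ) : Prop :=
  (i ≤ s.pos ∧ i' = i) ∨ ∃ d, i = s.pos + s.kind.top + d ∧ i' = s.pos + s.kind.bot + d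

theorem Joins.of_le {s : Slice} {i : ℕ} (h : i ≤ s.pos) : Joins s i i := .inl ⟨h, rfl⟩

theorem Joins.of_ge {s : Slice} {i : ℕ} (h : s.pos + s.kind.bot ≤ i) :
    Joins s (i - s.kind.bot + s.kind.top) i :=
  .inr ⟨i - (s.pos + s.kind.bot), by omega, by omega⟩

theorem width_append (n : ℕ) (u v : List Slice) : width n (u ++ v) = width (width n u) v := by
  induction u generalizing n with
  | nil => rfl
  | cons s _ ih => exact ih _

section Faces

variable {w : List Slice} {f f' : Face w} {s : Slice} {t i i' : ℕ}

theorem strandsAt_succ (h : w[t]? = some s) :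
    strandsAt w (t + 1) = strandsAt w t - s.kind.top + s.kind.bot := by
  rw [strandsAt, List.take_add_one, width_append, h]
  rfl

/-- The face `f` contains the interval number `i` at height `t`. -/
def Contains (f : Face w) (t i : ℕ) : Prop :=
  ∃ c : Gap w, Quot.mk _ c = f ∧ (c.1 : ℕ) = t ∧ (c.2 : ℕ) = i

theorem exists_contains_of_le (ht : t ≤ w.length) (hi : i ≤ strandsAt w t) :
    ∃ f : Face w, Contains f t i :=
  ⟨_, ⟨⟨t, Nat.lt_succ_of_le ht⟩, ⟨i, Nat.lt_succ_of_le hi⟩⟩, rfl, rfl, rfl⟩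

theorem exists_contains (f : Face w) : ∃ t i, Contains f t i := by
  obtain ⟨c, rfl⟩ := Quot.exists_rep f
  exact ⟨_, _, c, rfl, rfl, rfl⟩

theorem Contains.height_le (h : Contains f t i) : t ≤ w.length := by
  obtain ⟨c, -, rfl, -⟩ := h
  exact Nat.le_of_lt_succ c.1.2

theorem Contains.le_strandsAt (h : Contains f t i) : i ≤ strandsAt w t := by
  obtain ⟨c, -, rfl, rfl⟩ := h
  exact Nat.le_of_lt_succ c.2.2

theorem Contains.eq (h : Contains f t i) (h' : Contains f' t i) : f = f' := by
  obtain ⟨⟨⟨t, ht⟩, ⟨i, hi⟩⟩, rfl, rfl, rfl⟩ := h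
  obtain ⟨⟨⟨t', ht'⟩, ⟨i', hi'⟩⟩, rfl, rfl, rfl⟩ := h'
  rfl

theorem contains_succ_iff (hs : w[t]? = some s) (h : Joins s i i') (hi : i ≤ strandsAt w t)
    (hi' : i' ≤ strandsAt w (t + 1)) : Contains f (t + 1) i' ↔ Contains f t i := by
  have ht : t < w.length := (List.getElem?_eq_some_iff.1 hs).1
  obtain ⟨-, c, -, rfl, rfl⟩ := exists_contains_of_le ht.le hi
  obtain ⟨-, c', -, ht', rfl⟩ := exists_contains_of_le (t := c.1 + 1) ht hi'
  have glued : (Quot.mk _ c : Face w) = Quot.mk _ c' := Quot.sound ⟨s, hs, ht', h⟩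
  exact ⟨fun h' => ⟨c, glued.trans (h'.eq ⟨c', rfl, ht', rfl⟩).symm, rfl, rfl⟩,
    fun h' => ⟨c', glued.symm.trans (h'.eq ⟨c, rfl, rfl, rfl⟩).symm, ht', rfl⟩⟩

theorem Closes.pos_add_top_le {n : ℕ} (hw : Closes n w) (hs : w[t]? = some s) :
    s.pos + s.kind.top ≤ width n (w.take t) := by
  induction w generalizing n t with
  | nil => simp at hs
  | cons s' w ih =>
    cases t with
    | zero => exact Option.some.inj hs ▸ hw.1
    | succ t => exact ih hw.2 hs

theorem exists_joins_above (hw : Closes 0 w) (hs : w[t]? = some s)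
    (hi : i ≤ strandsAt w (t + 1)) (hsi : i ≤ s.pos ∨ s.pos + s.kind.bot ≤ i) :
    ∃ i', i' ≤ strandsAt w t ∧ Joins s i' i := by
  have fits : s.pos + s.kind.top ≤ strandsAt w t := hw.pos_add_top_le hs
  rw [strandsAt_succ hs] at hi
  rcases hsi with h | h
  · exact ⟨i, by omega, .of_le h⟩
  · exact ⟨i - s.kind.bot + s.kind.top, by omega, .of_ge h⟩

theorem touches_iff_contains {v : Crossing w} (hs : w.get v.1 = s) :
    Touches v f ↔ Contains f v.1 s.pos ∨ Contains f v.1 (s.pos + 1) ∨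
      Contains f v.1 (s.pos + 2) ∨ Contains f (v.1 + 1) (s.pos + 1) := by
  simp only [Touches, Contains, hs, ← exists_or, ← and_or_left]
  simp only [and_or_left, or_assoc]

theorem beside_iff_contains : Beside t i f ↔ Contains f t i ∨ Contains f t (i + 1) := by
  simp only [Beside, Contains, ← exists_or, ← and_or_left]

end Faces

/-! ### The faces of the torus link diagram -/

section TorusLink

variable {q t i i' l : ℕ}

theorem length_torusLink (q : ℕ) : (torusLink q).word.length = q + 4 := by
  simp [torusLink]

theorem getElem?_torusLink (q t : ℕ) : (torusLink q).word[t]? =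
    if t = 0 then some (birth 0) else if t = 1 then some (birth 1)
    else if t < q + 2 then some (cross true 0) else if t = q + 2 then some (death 1)
    else if t = q + 3 then some (death 0) else none := by
  match t with
  | 0 => rfl
  | 1 => rfl
  | t + 2 =>
    simp only [torusLink, List.cons_append, List.nil_append, List.getElem?_cons_succ]
    rw [List.getElem?_append, List.length_replicate]
    by_cases h : t < q
    · simp [h]
    · obtain ⟨k, rfl⟩ := Nat.exists_eq_add_of_le (not_lt.1 h)
      match k with
      | 0 => simp
      | 1 => simp
      | k + 2 => simp

theorem getElem?_torusLink_eq_some_iff {s : Slice} : (torusLink q).word[t]? = some s ↔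
    (t = 0 ∧ s = birth 0) ∨ (t = 1 ∧ s = birth 1) ∨ (2 ≤ t ∧ t < q + 2 ∧ s = cross true 0) ∨
      (t = q + 2 ∧ s = death 1) ∨ (t = q + 3 ∧ s = death 0) := by
  rw [getElem?_torusLink]
  grind

theorem strandsAt_torusLink (ht : t ≤ q + 4) : strandsAt (torusLink q).word t =
    if t = 0 ∨ t = q + 4 then 0 else if t = 1 ∨ t = q + 3 then 2 else 4 := by
  induction t with
  | zero => rfl
  | succ t ih =>
    obtain ⟨s, hs⟩ : ∃ s, (torusLink q).word[t]? = some s :=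
      ⟨_, List.getElem?_eq_getElem (by rw [length_torusLink]; omega)⟩
    rw [strandsAt_succ hs, ih (by omega)]
    rcases getElem?_torusLink_eq_some_iff.1 hs with
      ⟨ht, rfl⟩ | ⟨ht, rfl⟩ | ⟨h2, ht, rfl⟩ | ⟨ht, rfl⟩ | ⟨ht, rfl⟩ <;>
      simp only [Kind.top, Kind.bot] <;> grind

/-- The number of the face of the torus link diagram that contains the interval number `i` at
height `t`: `0` for the outside face, `j` for the bigon between the crossings number `j - 1` and
`j`, `q` for the shaded face outside the bigons and `q + 1` for the inner unshaded face. -/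
def gapLabel (q t i : ℕ) : ℕ :=
  if i = 0 ∨ i = 4 ∨ (i = 2 ∧ (t ≤ 1 ∨ q + 3 ≤ t)) then 0
  else if i = 2 then q + 1
  else if i = 1 ∧ 3 ≤ t ∧ t ≤ q + 1 then t - 2 else q

theorem gapLabel_le (q t i : ℕ) : gapLabel q t i ≤ q + 1 := by
  unfold gapLabel
  split_ifs <;> omega

theorem Joins.gapLabel_eq {s : Slice} (h : Joins s i i') (hs : (torusLink q).word[t]? = some s)
    (hi : i ≤ strandsAt (torusLink q).word t) (hi' : i' ≤ strandsAt (torusLink q).word (t + 1)) :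
    gapLabel q t i = gapLabel q (t + 1) i' := by
  have ht : t < (torusLink q).word.length := (List.getElem?_eq_some_iff.1 hs).1
  rw [length_torusLink] at ht
  rw [strandsAt_torusLink (by omega)] at hi hi'
  rcases getElem?_torusLink_eq_some_iff.1 hs with
    ⟨ht, rfl⟩ | ⟨ht, rfl⟩ | ⟨h2, ht, rfl⟩ | ⟨ht, rfl⟩ | ⟨ht, rfl⟩ <;>
    simp only [Joins, Kind.top, Kind.bot] at h <;> unfold gapLabel <;> grind

/-- The number of a face of the torus link diagram, see `gapLabel`. -/
def faceLabel : Face (torusLink q).word → ℕ :=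
  Quot.lift (fun c => gapLabel q c.1 c.2) fun c c' ⟨_, hs, ht, h⟩ => by
    simpa only [ht] using Joins.gapLabel_eq h hs (Nat.le_of_lt_succ c.2.2)
      (by rw [← ht]; exact Nat.le_of_lt_succ c'.2.2)

theorem Contains.faceLabel_eq {f : Face (torusLink q).word} (h : Contains f t i) :
    faceLabel f = gapLabel q t i := by
  obtain ⟨c, rfl, rfl, rfl⟩ := h
  rfl

theorem faceLabel_le (f : Face (torusLink q).word) : faceLabel f ≤ q + 1 := by
  obtain ⟨t, i, h⟩ := exists_contains f
  exact h.faceLabel_eq ▸ gapLabel_le q t i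

/-- Height and number of a topmost interval of the face with number `l`. -/
def topGap (q l : ℕ) : ℕ × ℕ :=
  if l = 0 then (0, 0) else if l = q then (1, 1) else if l = q + 1 then (2, 2) else (l + 2, 1)

/- A face continues upwards except at its maxima: these are the topmost intervals and, for the
shaded face outside the bigons, the interval below the last crossing. -/
theorem topGap_gapLabel_eq_or {s : Slice} (hq : 1 ≤ q) (hs : (torusLink q).word[t]? = some s)
    (hi : s.pos < i) (hi' : i < s.pos + s.kind.bot) :
    topGap q (gapLabel q (t + 1) i) = (t + 1, i) ∨ (t + 1 = q + 2 ∧ i = 1) := by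
  rcases getElem?_torusLink_eq_some_iff.1 hs with
    ⟨ht, rfl⟩ | ⟨ht, rfl⟩ | ⟨h2, ht, rfl⟩ | ⟨-, rfl⟩ | ⟨-, rfl⟩ <;>
    simp only [Kind.bot] at hi' <;> grind [gapLabel, topGap]

theorem contains_succ_succ_one_iff (hq : 1 ≤ q) {f : Face (torusLink q).word} :
    Contains f (q + 2) 1 ↔ Contains f (q + 1) 3 := by
  have last : (torusLink q).word[q + 1]? = some (cross true 0) :=
    getElem?_torusLink_eq_some_iff.2 (by grind)
  have minimum : (torusLink q).word[q + 2]? = some (death 1) :=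
    getElem?_torusLink_eq_some_iff.2 (by grind)
  have strands (t : ℕ) (ht : t ≤ q + 4) := strandsAt_torusLink (q := q) ht
  rw [← contains_succ_iff minimum (i := 1) (i' := 1) (.inl ⟨le_rfl, rfl⟩) (by grind) (by grind),
    contains_succ_iff minimum (i := 3) (i' := 1) (.inr ⟨0, rfl, rfl⟩) (by grind) (by grind),
    contains_succ_iff last (i := 3) (i' := 3) (.inr ⟨1, rfl, rfl⟩) (by grind) (by grind)]

theorem Contains.topGap (hq : 1 ≤ q) {f : Face (torusLink q).word} (h : Contains f t i) :
    Contains f (topGap q (faceLabel f)).1 (topGap q (faceLabel f)).2 := by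
  induction t generalizing i with
  | zero =>
    obtain rfl : i = 0 := Nat.le_zero.1 h.le_strandsAt
    rw [h.faceLabel_eq]
    exact h
  | succ t ih =>
    obtain ⟨s, hs⟩ : ∃ s, (torusLink q).word[t]? = some s :=
      ⟨_, List.getElem?_eq_getElem h.height_le⟩
    by_cases hsi : i ≤ s.pos ∨ s.pos + s.kind.bot ≤ i
    · obtain ⟨i', hi', joins⟩ := exists_joins_above (torusLink q).closes hs h.le_strandsAt hsi
      exact ih ((contains_succ_iff hs joins hi' h.le_strandsAt).1 h)
    · rcases topGap_gapLabel_eq_or (i := i) hq hs (by omega) (by omega) with top | ⟨ht, rfl⟩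
      · rwa [h.faceLabel_eq, top]
      · obtain rfl : t = q + 1 := by omega
        exact ih ((contains_succ_succ_one_iff hq).1 h)

theorem faceLabel_injective (hq : 1 ≤ q) : Function.Injective (faceLabel (q := q)) := by
  intro f f' hff'
  obtain ⟨t, i, h⟩ := exists_contains f
  obtain ⟨t', i', h'⟩ := exists_contains f'
  exact (h.topGap hq).eq (hff' ▸ h'.topGap hq)

theorem contains_iff_faceLabel_eq (hq : 1 ≤ q) (ht : t ≤ q + 4)
    (hi : i ≤ strandsAt (torusLink q).word t) (f : Face (torusLink q).word) :
    Contains f t i ↔ faceLabel f = gapLabel q t i := by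
  refine ⟨Contains.faceLabel_eq, fun h => ?_⟩
  obtain ⟨f', hf'⟩ := exists_contains_of_le (length_torusLink q ▸ ht) hi
  rwa [faceLabel_injective hq (h.trans hf'.faceLabel_eq.symm)]

theorem beside_torusLink (hq : 1 ≤ q) (f : Face (torusLink q).word) :
    Beside 2 2 f ↔ q ≤ faceLabel f := by
  have strands : strandsAt (torusLink q).word 2 = 4 := rfl
  have label_le := faceLabel_le f
  rw [beside_iff_contains, contains_iff_faceLabel_eq hq (by omega) (by omega),
    contains_iff_faceLabel_eq hq (by omega) (by omega)]
  grind [gapLabel]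

theorem kind_get_torusLink (v : Fin (torusLink q).word.length) :
    (∃ ε, ((torusLink q).word.get v).kind = .cross ε) ↔ 2 ≤ (v : ℕ) ∧ (v : ℕ) < q + 2 := by
  have hs := getElem?_torusLink_eq_some_iff.1 (List.getElem?_eq_getElem v.2)
  rw [List.get_eq_getElem]
  grind

theorem get_torusLink_crossing (v : Crossing (torusLink q).word) :
    (torusLink q).word.get v.1 = cross true 0 := by
  have hv := (kind_get_torusLink v.1).1 v.2
  have hs := getElem?_torusLink_eq_some_iff.1 (List.getElem?_eq_getElem v.1.2)
  rw [List.get_eq_getElem]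
  grind

/-- The numbering of the crossings of the torus link diagram from top to bottom, as an
equivalence. -/
def crossingEquiv (q : ℕ) : Fin q ≃ Crossing (torusLink q).word where
  toFun j := ⟨⟨j + 2, by rw [length_torusLink]; omega⟩, (kind_get_torusLink _).2 (by simp)⟩
  invFun v := ⟨v.1 - 2, by have := (kind_get_torusLink v.1).1 v.2; omega⟩
  left_inv _ := rfl
  right_inv v := by
    have := (kind_get_torusLink v.1).1 v.2
    ext
    simp only
    omega

theorem crossingEquiv_val (j : Fin q) : ((crossingEquiv q j).1 : ℕ) = j + 2 := rfl

theorem crossingEquiv_le_iff {i j : Fin q} : crossingEquiv q i ≤ crossingEquiv q j ↔ i ≤ j := by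
  rw [← Subtype.coe_le_coe, Fin.le_def, Fin.le_def, crossingEquiv_val, crossingEquiv_val]
  omega

theorem touches_torusLink (j : Fin q) {f : Face (torusLink q).word} (hf : faceLabel f < q) :
    Touches (crossingEquiv q j) f ↔
      faceLabel f = 0 ∨ faceLabel f = j ∨ faceLabel f = j + 1 := by
  have hq : 1 ≤ q := by omega
  have strands (t : ℕ) (ht : t ≤ q + 4) := strandsAt_torusLink (q := q) ht
  rw [touches_iff_contains (get_torusLink_crossing _), crossingEquiv_val,
    contains_iff_faceLabel_eq hq (by omega) (by grind),
    contains_iff_faceLabel_eq hq (by omega) (by grind),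
    contains_iff_faceLabel_eq hq (by omega) (by grind),
    contains_iff_faceLabel_eq hq (by omega) (by grind)]
  grind [gapLabel]

theorem exists_faceLabel_eq (hl : l < q) : ∃ f : Face (torusLink q).word, faceLabel f = l := by
  have strands := strandsAt_torusLink (q := q) (t := l + 2) (by omega)
  have length := length_torusLink q
  by_cases h : l = 0
  · obtain ⟨f, hf⟩ := exists_contains_of_le (w := (torusLink q).word) (t := 0) (i := 0)
      (Nat.zero_le _) (Nat.zero_le _)
    exact ⟨f, by grind [hf.faceLabel_eq, gapLabel]⟩
  · obtain ⟨f, hf⟩ := exists_contains_of_le (w := (torusLink q).word) (t := l + 2) (i := 1)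
      (by omega) (by grind)
    exact ⟨f, by grind [hf.faceLabel_eq, gapLabel]⟩

theorem shaded_iff_faceLabel_ne_zero {f : Face (torusLink q).word} (hf : faceLabel f < q) :
    Shaded f ↔ faceLabel f ≠ 0 := by
  obtain ⟨⟨⟨t, ht⟩, ⟨i, hi⟩⟩, rfl⟩ := Quot.exists_rep f
  rw [length_torusLink] at ht
  have strands := strandsAt_torusLink (q := q) (t := t) (by omega)
  change i < strandsAt (torusLink q).word t + 1 at hi
  change gapLabel q t i < q at hf
  change Odd i ↔ gapLabel q t i ≠ 0
  grind [gapLabel]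

end TorusLink

/-- The numbering of the faces of the torus link diagram other than the two omitted ones by
`faceLabel`, as an equivalence. -/
noncomputable def taitFaceEquiv (n : ℕ) : Fin (n + 1) ≃ TaitFace (torusLink (n + 1)).word 2 2 :=
  (Equiv.ofBijective
    (fun f : TaitFace (torusLink (n + 1)).word 2 2 =>
      (⟨faceLabel f.1, not_le.1 fun h => f.2 ((beside_torusLink (by omega) _).2 h)⟩ : Fin (n + 1)))
    ⟨fun f f' h => Subtype.ext (faceLabel_injective (by omega) (Fin.ext_iff.1 h)), fun l => by
      obtain ⟨f, hf⟩ := exists_faceLabel_eq l.2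
      exact ⟨⟨f, fun h => by have := (beside_torusLink (by omega) f).1 h; omega⟩, Fin.ext hf⟩⟩).symm

section TaitGraph

variable {n : ℕ} (j l : Fin (n + 1))

theorem faceLabel_taitFaceEquiv : faceLabel (taitFaceEquiv n l).1 = l :=
  Fin.ext_iff.1 ((taitFaceEquiv n).symm_apply_apply l)

theorem touches_taitFaceEquiv : Touches (crossingEquiv (n + 1) j) (taitFaceEquiv n l).1 ↔
    (l : ℕ) = 0 ∨ (l : ℕ) = j ∨ (l : ℕ) = j + 1 := by
  rw [touches_torusLink j (by rw [faceLabel_taitFaceEquiv]; exact l.2), faceLabel_taitFaceEquiv]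

theorem first_taitFaceEquiv_iff
    (h : Touches (crossingEquiv (n + 1) j) (taitFaceEquiv n l).1) :
    (∀ v, Touches v (taitFaceEquiv n l).1 → crossingEquiv (n + 1) j ≤ v) ↔
      if (l : ℕ) = 0 then (j : ℕ) = 0 else (l : ℕ) = j + 1 := by
  rw [touches_taitFaceEquiv] at h
  rw [(crossingEquiv (n + 1)).forall_congr_right.symm]
  simp only [touches_taitFaceEquiv, crossingEquiv_le_iff, Fin.le_def]
  constructor
  · intro first
    have := first ⟨l - 1, by omega⟩
    grind
  · grind

/-- The letters of the torus link diagram in terms of the numbers of crossings and faces. -/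
def torusLetter (j l : ℕ) : Letter :=
  if l = 0 then if j = 0 then .ell else .d else if l = j + 1 then .L else .D

theorem letter_taitFaceEquiv (h : Touches (crossingEquiv (n + 1) j) (taitFaceEquiv n l).1) :
    letter (crossingEquiv (n + 1) j) (taitFaceEquiv n l).1 = torusLetter j l := by
  have label_lt : faceLabel (taitFaceEquiv n l).1 < n + 1 :=
    (faceLabel_taitFaceEquiv l).trans_lt l.2
  simp only [letter, first_taitFaceEquiv_iff j l h, torusLetter,
    shaded_iff_faceLabel_ne_zero label_lt, faceLabel_taitFaceEquiv]
  grind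

end TaitGraph

/-! ### Perfect matchings and the permanent -/

section EquivGraph

variable {α β : Type*} [Fintype α] {e : α ≃ β}

/-- The graph of an equivalence, as a finite set of pairs. -/
def equivGraph (e : α ≃ β) : Finset (α × β) :=
  Finset.univ.map ⟨fun a => (a, e a), fun _ _ h => (Prod.ext_iff.1 h).1⟩

theorem mem_equivGraph {p : α × β} : p ∈ equivGraph e ↔ e p.1 = p.2 := by
  constructor
  · rintro h
    obtain ⟨a, -, rfl⟩ := Finset.mem_map.1 h
    rfl
  · exact fun h => Finset.mem_map.2 ⟨p.1, Finset.mem_univ _, Prod.ext rfl h⟩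

theorem prod_equivGraph {R : Type*} [CommMonoid R] (F : α × β → R) :
    ∏ p ∈ equivGraph e, F p = ∏ a, F (a, e a) :=
  Finset.prod_map _ _ _

theorem equivGraph_injective : Function.Injective (equivGraph : (α ≃ β) → Finset (α × β)) :=
  fun e _ h => Equiv.ext fun a =>
    (mem_equivGraph (p := (a, e a)).1 (h ▸ mem_equivGraph.2 rfl)).symm

theorem exists_equivGraph_eq_iff {M : Finset (α × β)} :
    (∃ e, equivGraph e = M) ↔ (∀ a, ∃! b, (a, b) ∈ M) ∧ ∀ b, ∃! a, (a, b) ∈ M := by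
  constructor
  · rintro ⟨e, rfl⟩
    simp only [mem_equivGraph]
    exact ⟨fun a => ⟨e a, rfl, fun _ h => h.symm⟩, e.bijective.existsUnique⟩
  · rintro ⟨existsUnique_right, existsUnique_left⟩
    choose s s_mem s_unique using existsUnique_right
    have graph (a : α) (b : β) : (a, b) ∈ M ↔ s a = b :=
      ⟨fun h => (s_unique a b h).symm, fun h => h ▸ s_mem a⟩
    simp only [graph] at existsUnique_left
    refine ⟨.ofBijective s ((Function.bijective_iff_existsUnique s).2 existsUnique_left), ?_⟩
    ext p
    rw [mem_equivGraph, Equiv.ofBijective_apply, graph]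

end EquivGraph

section MatchingPolynomial

variable {w : List Slice} {t g : ℕ}

theorem isPerfectMatching_iff {M : Finset (Crossing w × TaitFace w t g)} :
    IsPerfectMatching M ↔ (∀ p ∈ M, Touches p.1 p.2.1) ∧ ∃ e, equivGraph e = M := by
  rw [exists_equivGraph_eq_iff, IsPerfectMatching]

open Classical in
theorem matchingPolynomial_eq_sum_equiv : matchingPolynomial w t g =
    ∑ e : Crossing w ≃ TaitFace w t g, ∏ v, adjacencyMatrix w t g v (e v) := by
  calc matchingPolynomial w t g
    _ = ∑ M ∈ Finset.univ.map ⟨equivGraph, equivGraph_injective⟩,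
          ∏ p ∈ M, adjacencyMatrix w t g p.1 p.2 := by
      refine Finset.sum_subset_zero_on_sdiff (fun M hM => ?_) (fun M hM => ?_) fun M hM => ?_
      · simpa using (isPerfectMatching_iff.1 (Finset.mem_filter.1 hM).2).2
      · obtain ⟨hM, hM'⟩ := Finset.mem_sdiff.1 hM
        obtain ⟨e, -, rfl⟩ := Finset.mem_map.1 hM
        have no_matching : ¬ IsPerfectMatching (equivGraph e) := fun h =>
          hM' (Finset.mem_filter.2 ⟨Finset.mem_univ _, h⟩)
        rw [isPerfectMatching_iff, and_iff_left ⟨e, rfl⟩] at no_matching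
        push Not at no_matching
        obtain ⟨p, hp, hp'⟩ := no_matching
        exact Finset.prod_eq_zero hp (if_neg hp')
      · have touch := (isPerfectMatching_iff.1 (Finset.mem_filter.1 hM).2).1
        exact Finset.prod_congr rfl fun p hp => (if_pos (touch p hp)).symm
    _ = _ := by
      rw [Finset.sum_map]
      exact Finset.sum_congr rfl fun e _ => prod_equivGraph _

theorem matchingPolynomial_eq_permanent {ι : Type*} [Fintype ι] [DecidableEq ι]
    (c : ι ≃ Crossing w) (f : ι ≃ TaitFace w t g) :
    matchingPolynomial w t g = ((adjacencyMatrix w t g).submatrix c f).permanent := by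
  classical
  rw [matchingPolynomial_eq_sum_equiv, ← Matrix.permanent_transpose, Matrix.permanent]
  refine (Fintype.sum_equiv (Equiv.equivCongr c f) _ _ fun σ => ?_).symm
  refine Fintype.prod_equiv c _ _ fun i => ?_
  simp

end MatchingPolynomial

/-! ### Bordered bidiagonal matrices -/

section BorderedBidiagonal

variable {n : ℕ} {R : Type*} [CommRing R] {A : Matrix (Fin (n + 1)) (Fin (n + 1)) R}

/-- All nonzero entries lie in the first column, on the diagonal or on the first superdiagonal. -/
def IsBorderedBidiagonal (A : Matrix (Fin (n + 1)) (Fin (n + 1)) R) : Prop :=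
  ∀ i l : Fin (n + 1), A i l ≠ 0 → (l : ℕ) = 0 ∨ (l : ℕ) = i ∨ (l : ℕ) = i + 1

theorem cycleRange_val_cases (k i : Fin (n + 1)) :
    (i < k ∧ (Fin.cycleRange k i : ℕ) = i + 1) ∨ (i = k ∧ (Fin.cycleRange k i : ℕ) = 0) ∨
      (k < i ∧ (Fin.cycleRange k i : ℕ) = i) := by
  rcases lt_trichotomy i k with hi | rfl | hi
  · exact .inl ⟨hi, Fin.coe_cycleRange_of_lt hi⟩
  · exact .inr (.inl ⟨rfl, by rw [Fin.cycleRange_self]; rfl⟩)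
  · exact .inr (.inr ⟨hi, by rw [Fin.cycleRange_of_gt hi]⟩)

theorem cycleRange_eq_zero_iff (k i : Fin (n + 1)) : Fin.cycleRange k i = 0 ↔ i = k := by
  rw [← Fin.cycleRange_self k, (Fin.cycleRange k).injective.eq_iff]

theorem cycleRange_injective :
    Function.Injective (Fin.cycleRange : Fin (n + 1) → Equiv.Perm (Fin (n + 1))) := by
  intro k l h
  rw [← cycleRange_eq_zero_iff, ← h, Fin.cycleRange_self]

/- If `i` is mapped to `i + 1`, then `i + 1` has to be mapped to `i + 2`, and so on until the
number mapped to `0` is reached. -/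
theorem apply_eq_succ_of_le {σ : Equiv.Perm (Fin (n + 1))}
    (hσ : ∀ i, (σ i : ℕ) = 0 ∨ (σ i : ℕ) = i ∨ (σ i : ℕ) = i + 1) {i j : Fin (n + 1)}
    (hij : i ≤ j) (hi : (σ i : ℕ) = i + 1) (h0 : ∀ l, i ≤ l → l ≤ j → σ l ≠ 0) :
    (σ j : ℕ) = j + 1 := by
  induction j using Fin.induction with
  | zero => rwa [← Fin.le_zero_iff.1 hij]
  | succ j ih =>
    rcases hij.eq_or_lt with rfl | hlt
    · exact hi
    have hle : i ≤ j.castSucc := Fin.le_castSucc_iff.2 hlt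
    have previous : (σ j.castSucc : ℕ) = j + 1 :=
      ih hle fun l hl hlj => h0 l hl (hlj.trans j.castSucc_le_succ)
    have ne_succ : (σ j.succ : ℕ) ≠ j + 1 := fun h =>
      j.castSucc_lt_succ.ne (σ.injective (Fin.ext (previous.trans h.symm)))
    have ne_zero := Fin.val_ne_zero_iff.2 (h0 j.succ hij le_rfl)
    have := hσ j.succ
    rw [Fin.val_succ] at this ⊢
    omega

theorem eq_cycleRange {σ : Equiv.Perm (Fin (n + 1))}
    (hσ : ∀ i, (σ i : ℕ) = 0 ∨ (σ i : ℕ) = i ∨ (σ i : ℕ) = i + 1) :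
    σ = Fin.cycleRange (σ.symm 0) := by
  have ne_zero (i : Fin (n + 1)) (hi : i ≠ σ.symm 0) : σ i ≠ 0 := fun h =>
    hi (σ.symm_apply_eq.2 h.symm).symm
  refine Equiv.ext fun i => Fin.ext ?_
  rcases cycleRange_val_cases (σ.symm 0) i with ⟨hi, h⟩ | ⟨hi, h⟩ | ⟨hi, h⟩ <;> rw [h]
  · have start : (σ 0 : ℕ) = 0 + 1 := by
      have := Fin.val_ne_zero_iff.2 (ne_zero 0 ((Fin.zero_le i).trans_lt hi).ne)
      have := hσ 0
      rw [Fin.val_zero] at this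
      omega
    exact apply_eq_succ_of_le hσ (Fin.zero_le i) start fun l _ hl =>
      ne_zero l (hl.trans_lt hi).ne
  · rw [hi, σ.apply_symm_apply, Fin.val_zero]
  · have not_succ : (σ i : ℕ) ≠ i + 1 := fun h' => by
      have := apply_eq_succ_of_le hσ (Fin.le_last i) h' fun l hl _ =>
        ne_zero l (hi.trans_le hl).ne'
      rw [Fin.val_last] at this
      omega
    have := Fin.val_ne_zero_iff.2 (ne_zero i hi.ne')
    have := hσ i
    omega

theorem IsBorderedBidiagonal.prod_apply_perm_eq_zero (hA : IsBorderedBidiagonal A)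
    {σ : Equiv.Perm (Fin (n + 1))} (hσ : σ ∉ Set.range Fin.cycleRange) : ∏ i, A i (σ i) = 0 := by
  by_contra h
  refine hσ ⟨σ.symm 0, (eq_cycleRange fun i => hA i _ fun hi => h ?_).symm⟩
  exact Finset.prod_eq_zero (Finset.mem_univ i) hi

theorem IsBorderedBidiagonal.permanent_eq (hA : IsBorderedBidiagonal A) :
    A.permanent = ∑ k, ∏ i, A i (Fin.cycleRange k i) := by
  rw [← Matrix.permanent_transpose, Matrix.permanent]
  exact (Fintype.sum_of_injective _ cycleRange_injective _ _
    (fun σ hσ => hA.prod_apply_perm_eq_zero hσ) fun _ => rfl).symm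

theorem IsBorderedBidiagonal.det_eq (hA : IsBorderedBidiagonal A) :
    A.det = ∑ k : Fin (n + 1), Equiv.Perm.sign (Fin.cycleRange k) •
      ∏ i, A i (Fin.cycleRange k i) := by
  rw [← Matrix.det_transpose, Matrix.det_apply]
  exact (Fintype.sum_of_injective _ cycleRange_injective _ _
    (fun σ hσ => by
      simp only [Matrix.transpose_apply, hA.prod_apply_perm_eq_zero hσ, smul_zero])
    fun _ => rfl).symm

/-- Sign changes of the entries in the first column that turn the determinant into the permanent:
the sign in row `k` is that of the only permutation which uses that entry. -/
def firstColumnSign (k l : Fin (n + 1)) : ℤˣ :=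
  if l = 0 then Equiv.Perm.sign (Fin.cycleRange k) else 1

theorem prod_firstColumnSign (k : Fin (n + 1)) :
    ∏ i, firstColumnSign i (Fin.cycleRange k i) = Equiv.Perm.sign (Fin.cycleRange k) := by
  simp [firstColumnSign, cycleRange_eq_zero_iff]

theorem IsBorderedBidiagonal.det_firstColumnSign (hA : IsBorderedBidiagonal A) :
    (Matrix.of fun i l => (firstColumnSign i l : ℤ) • A i l).det = A.permanent := by
  have bordered : IsBorderedBidiagonal (Matrix.of fun i l => (firstColumnSign i l : ℤ) • A i l) :=
    fun i l h => hA i l fun h' => h (by rw [Matrix.of_apply, h', smul_zero])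
  rw [bordered.det_eq, hA.permanent_eq]
  refine Finset.sum_congr rfl fun k _ => ?_
  simp only [Matrix.of_apply, ← Units.smul_def]
  rw [Finset.prod_smul, prod_firstColumnSign, smul_smul, Int.units_mul_self, one_smul]

end BorderedBidiagonal

/-! ### The matching polynomial of the torus link -/

theorem adjacencyMatrix_torusLink {n : ℕ} (j l : Fin (n + 1)) :
    adjacencyMatrix (torusLink (n + 1)).word 2 2 (crossingEquiv (n + 1) j) (taitFaceEquiv n l) =
      if (l : ℕ) = 0 ∨ (l : ℕ) = j ∨ (l : ℕ) = j + 1 then MvPolynomial.X (torusLetter j l)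
      else 0 := by
  rw [adjacencyMatrix]
  by_cases h : Touches (crossingEquiv (n + 1) j) (taitFaceEquiv n l).1
  · rw [if_pos h, if_pos ((touches_taitFaceEquiv j l).1 h), letter_taitFaceEquiv j l h]
  · rw [if_neg h, if_neg (mt (touches_taitFaceEquiv j l).2 h)]

theorem isBorderedBidiagonal_torusLink (n : ℕ) :
    IsBorderedBidiagonal ((adjacencyMatrix (torusLink (n + 1)).word 2 2).submatrix
      (crossingEquiv (n + 1)) (taitFaceEquiv n)) := by
  intro j l h
  rw [Matrix.submatrix_apply, adjacencyMatrix_torusLink] at h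
  exact (ite_ne_right_iff.1 h).1

theorem matchingPolynomial_torusLink (n : ℕ) :
    matchingPolynomial (torusLink (n + 1)).word 2 2 =
      ∑ k : Fin (n + 1), ∏ i : Fin (n + 1),
        MvPolynomial.X (torusLetter i (Fin.cycleRange k i)) := by
  rw [matchingPolynomial_eq_permanent (crossingEquiv (n + 1)) (taitFaceEquiv n),
    (isBorderedBidiagonal_torusLink n).permanent_eq]
  refine Finset.sum_congr rfl fun k _ => Finset.prod_congr rfl fun i _ => ?_
  rw [Matrix.submatrix_apply, adjacencyMatrix_torusLink, if_pos]
  have := cycleRange_val_cases k i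
  tauto

theorem exists_det_eq_matchingPolynomial (n : ℕ) :
    ∃ (ε : Crossing (torusLink (n + 1)).word → TaitFace (torusLink (n + 1)).word 2 2 → ℤˣ)
      (e : Crossing (torusLink (n + 1)).word ≃ TaitFace (torusLink (n + 1)).word 2 2),
      (Matrix.of fun v v' : Crossing (torusLink (n + 1)).word =>
          (ε v (e v') : ℤ) • adjacencyMatrix (torusLink (n + 1)).word 2 2 v (e v')).det =
        matchingPolynomial (torusLink (n + 1)).word 2 2 := by
  let c := crossingEquiv (n + 1)
  let f := taitFaceEquiv n
  refine ⟨fun v l => firstColumnSign (c.symm v) (f.symm l), c.symm.trans f, ?_⟩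
  rw [matchingPolynomial_eq_permanent c f,
    ← (isBorderedBidiagonal_torusLink n).det_firstColumnSign, ← Matrix.det_submatrix_equiv_self c]
  congr 1
  ext j l : 2
  simp [c, f]

/-! ### The specialised matching polynomial -/

/-- The specialised letter at the crossing number `i` in the matching number `k`, the one in which
the outside face is matched with the crossing number `k`. -/
noncomputable def matchingWeight (k i : ℕ) : Laurent :=
  if i < k then mono 1 0 else if i = 0 ∧ k = 0 then mono (-1) 0 else mono 0 1

theorem specialize_torusLetter {n : ℕ} (k i : Fin (n + 1)) :
    specialize (torusLetter i (Fin.cycleRange k i)) = matchingWeight k i := by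
  rcases cycleRange_val_cases k i with ⟨hi, h⟩ | ⟨rfl, h⟩ | ⟨hi, h⟩
  · rw [h, torusLetter, if_neg (Nat.succ_ne_zero _), if_pos rfl, matchingWeight,
      if_pos (Fin.lt_def.1 hi), specialize]
  · rw [h, torusLetter, if_pos rfl, matchingWeight, if_neg (lt_irrefl _)]
    split_ifs <;> first | rfl | omega
  · have := Fin.lt_def.1 hi
    rw [h, torusLetter, if_neg (by omega), if_neg (by omega), matchingWeight, if_neg (by omega),
      if_neg (by omega), specialize]

theorem P_succ (n : ℕ) : P (n + 1) =
    ∑ k ∈ Finset.range (n + 1), ∏ i ∈ Finset.range (n + 1), matchingWeight k i := by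
  rw [P, matchingPolynomial_torusLink, map_sum,
    ← Fin.sum_univ_eq_sum_range fun k => ∏ i ∈ Finset.range (n + 1), matchingWeight k i]
  refine Finset.sum_congr rfl fun k _ => ?_
  simp only [map_prod, ← Fin.prod_univ_eq_prod_range, MvPolynomial.aeval_X, specialize_torusLetter]

theorem mono_pow (i j : ℤ) (n : ℕ) : mono i j ^ n = mono (n * i) (n * j) := by
  simp [mono, AddMonoidAlgebra.single_pow]

theorem P_one : P 1 = mono (-1) 0 := by
  simp [P_succ 0, matchingWeight]

theorem P_add_two (n : ℕ) : P (n + 2) = mono 0 1 * P (n + 1) + mono (n + 1) 1 := by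
  have old (k : ℕ) (hk : k ∈ Finset.range (n + 1)) :
      ∏ i ∈ Finset.range (n + 2), matchingWeight k i =
        mono 0 1 * ∏ i ∈ Finset.range (n + 1), matchingWeight k i := by
    have := Finset.mem_range.1 hk
    rw [Finset.prod_range_succ, mul_comm, matchingWeight, if_neg (by omega), if_neg (by omega)]
  have new : ∏ i ∈ Finset.range (n + 2), matchingWeight (n + 1) i = mono (n + 1) 1 := by
    rw [Finset.prod_range_succ, matchingWeight, if_neg (lt_irrefl _), if_neg (by omega),
      Finset.prod_congr rfl fun i hi => by rw [matchingWeight, if_pos (Finset.mem_range.1 hi)],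
      Finset.prod_const, Finset.card_range, mono_pow, mono_mul_mono]
    simp
  rw [P_succ (n + 1), P_succ n, Finset.sum_range_succ, Finset.sum_congr rfl old, new,
    Finset.mul_sum]

theorem torusPolynomial_eq {q : ℕ} (hq : 1 ≤ q) :
    torusPolynomial q = P q - ∑ i ∈ Finset.range (q - 1), P i * g (q - 2 - i) := by
  obtain ⟨n, rfl⟩ := Nat.exists_eq_add_of_le' hq
  refine eq_sub_sum_of_recursion (z := mono 0 1) (c := fun n => mono (n + 1) 1) ?_ ?_ ?_ ?_ ?_ ?_
    P_add_two n
  · rw [g]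
  · rw [g]
  · exact fun n => by rw [g]
  · rw [torusPolynomial, P]
  · rw [torusPolynomial, P_one]
  · exact fun n => by rw [torusPolynomial]

/-! ### Coefficient arrays -/

theorem mul_add_inj {b i j i' j' : ℤ} (hj : 0 ≤ j) (hjb : j < b) (hj' : 0 ≤ j') (hjb' : j' < b) :
    i * b + j = i' * b + j' ↔ i = i' ∧ j = j' := by
  refine ⟨fun h => ?_, fun ⟨hi, hj⟩ => by rw [hi, hj]⟩
  have division (i j : ℤ) (hj : 0 ≤ j) (hjb : j < b) : (i * b + j) / b = i ∧ (i * b + j) % b = j :=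
    (Int.ediv_emod_unique (hj.trans_lt hjb)).2 ⟨by ring, hj, hjb⟩
  exact ⟨(division i j hj hjb).1.symm.trans (h ▸ (division i' j' hj' hjb').1),
    (division i j hj hjb).2.symm.trans (h ▸ (division i' j' hj' hjb').2)⟩

section Output

variable {q : ℕ} {f f' : ℤ → ℤ}

theorem output_add (q : ℕ) (f f' : ℤ → ℤ) : output q (f + f') = output q f + output q f' := by
  simp only [output, Pi.add_apply, add_smul, Finset.sum_add_distrib]

theorem output_sub (q : ℕ) (f f' : ℤ → ℤ) : output q (f - f') = output q f - output q f' := by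
  simp only [output, Pi.sub_apply, sub_smul, Finset.sum_sub_distrib]

theorem output_single {i j : ℕ} (hi : i ≤ q) (hj : j ≤ q) {x : ℤ} (hx : x = i * (q + 1) + j) :
    output q (Pi.single x 1) = mono (i - 1) (j - 1) := by
  have entry (i' j' : ℕ) (hj' : j' ∈ Finset.range (q + 1)) :
      (Pi.single x 1 : ℤ → ℤ) ((i' : ℤ) * (q + 1) + j') =
        if i' = i ∧ j' = j then 1 else 0 := by
    have := Finset.mem_range.1 hj'
    rw [Pi.single_apply, hx]
    simp only [mul_add_inj (b := q + 1) (Nat.cast_nonneg j') (by omega) (Nat.cast_nonneg j)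
      (by omega), Nat.cast_inj]
  rw [output, Finset.sum_eq_single_of_mem i (Finset.mem_range.2 (by omega)),
    Finset.sum_eq_single_of_mem j (Finset.mem_range.2 (by omega))]
  · rw [← hx, Pi.single_eq_same, one_smul]
  · intro j' hj' hne
    rw [entry i j' hj', if_neg fun h => hne h.2, zero_smul]
  · intro i' _ hne
    exact Finset.sum_eq_zero fun j' hj' => by
      rw [entry i' j' hj', if_neg fun h => hne h.1, zero_smul]

theorem output_shift (hf : ∀ i : ℤ, f (i * (q + 1) + q) = 0) :
    output q (fun y => f (y - 1)) = mono 0 1 * output q f := by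
  rw [output, output, Finset.mul_sum]
  refine Finset.sum_congr rfl fun i _ => ?_
  have start : f (i * (q + 1) + ((0 : ℕ) : ℤ) - 1) = 0 := by
    rw [← hf (i - 1)]
    congr 1
    push_cast
    ring
  rw [Finset.sum_range_succ', start, zero_smul, add_zero, Finset.sum_range_succ, hf, zero_smul,
    add_zero, Finset.mul_sum]
  refine Finset.sum_congr rfl fun j _ => ?_
  rw [mul_smul_comm, mono_mul_mono, zero_add, Nat.cast_succ, ← add_assoc, add_sub_cancel_right,
    add_sub_cancel_right, add_sub_cancel]

theorem output_congr (h : ∀ x : ℤ, 0 ≤ x → x < (q + 1) * (q + 1) → f x = f' x) :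
    output q f = output q f' := by
  refine Finset.sum_congr rfl fun i hi => Finset.sum_congr rfl fun j hj => ?_
  have hi : (i : ℤ) ≤ q := by have := Finset.mem_range.1 hi; omega
  have hj : (j : ℤ) < q + 1 := by exact_mod_cast Finset.mem_range.1 hj
  rw [h _ (by positivity) (by nlinarith)]

end Output

/-- The arrays of the inhomogeneous terms of the recursion for `torusPolynomial`, in the encoding
of `output`: the coefficient of `a ^ (i - 1) * z ^ (j - 1)` stands at `i * (q + 1) + j`. -/
def seed (q : ℕ) : ℕ → ℤ → ℤ
  | 0 => Pi.single (2 * ((q : ℤ) + 1)) 1 - Pi.single ((q : ℤ) + 2) 1 + Pi.single 0 1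
  | 1 => Pi.single 1 1
  | n + 2 => Pi.single (((n : ℤ) + 2) * (q + 1) + 2) 1

/-- The coefficient array of `torusPolynomial`. -/
def torusArray (q : ℕ) : ℕ → ℤ → ℤ
  | 0 => seed q 0
  | 1 => seed q 1
  | n + 2 => seed q (n + 2) + (fun y => torusArray q (n + 1) (y - 1)) - torusArray q n

section TorusArray

variable {q n : ℕ}

theorem torusArray_eq_zero_of_lt_column {i j : ℤ} (hn : n < j) (hj : 1 < j) (hjq : j ≤ q) :
    torusArray q n (i * (q + 1) + j) = 0 := by
  have ne (i j i' j' : ℤ) (hj' : 0 ≤ j') (h : j' < j) (hjq : j ≤ q) :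
      i * (q + 1) + j ≠ i' * (q + 1) + j' := fun h' =>
    h.ne' ((mul_add_inj (by omega) (by omega) hj' (by omega)).1 h').2
  induction n using Nat.twoStepInduction generalizing i j with
  | zero =>
    have h₁ := ne i j 2 0 le_rfl (by omega) hjq
    have h₂ := ne i j 1 1 zero_le_one hj hjq
    have h₃ := ne i j 0 0 le_rfl (by omega) hjq
    rw [torusArray, seed, Pi.add_apply, Pi.sub_apply, Pi.single_eq_of_ne (by omega),
      Pi.single_eq_of_ne (by omega), Pi.single_eq_of_ne (by omega), sub_zero, add_zero]
  | one =>
    have h := ne i j 0 1 zero_le_one hj hjq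
    rw [torusArray, seed, Pi.single_eq_of_ne (by omega)]
  | more n ih₀ ih₁ =>
    push_cast at hn
    have shifted := ih₁ (i := i) (j := j - 1) (by push_cast; omega) (by omega) (by omega)
    rw [← add_sub_assoc] at shifted
    rw [torusArray, seed, Pi.sub_apply, Pi.add_apply,
      Pi.single_eq_of_ne (ne i j (n + 2) 2 zero_le_two (by omega) hjq), shifted,
      ih₀ (by omega) hj hjq, add_zero, sub_zero]

theorem torusArray_eq_zero_of_gt (hq : 2 ≤ q) (hn : n ≤ q) {y : ℤ} (hy : q * (q + 1) + n < y) :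
    torusArray q n y = 0 := by
  have hb : 2 * ((q : ℤ) + 1) ≤ q * (q + 1) := by nlinarith
  induction n using Nat.twoStepInduction generalizing y with
  | zero =>
    rw [torusArray, seed, Pi.add_apply, Pi.sub_apply, Pi.single_eq_of_ne (by omega),
      Pi.single_eq_of_ne (by omega), Pi.single_eq_of_ne (by omega), sub_zero, add_zero]
  | one => rw [torusArray, seed, Pi.single_eq_of_ne (by omega)]
  | more n ih₀ ih₁ =>
    have : ((n : ℤ) + 2) * (q + 1) ≤ q * (q + 1) := by gcongr; exact_mod_cast hn
    push_cast at hy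
    rw [torusArray, seed, Pi.sub_apply, Pi.add_apply, Pi.single_eq_of_ne (by omega),
      ih₀ (by omega) (by omega), ih₁ (by omega) (by push_cast; omega), add_zero, sub_zero]

theorem output_seed_zero (hq : 2 ≤ q) : output q (seed q 0) = delta := by
  rw [seed, output_add, output_sub, output_single (i := 2) (j := 0) hq q.zero_le (by simp),
    output_single (i := 1) (j := 1) (by omega) (by omega) (by push_cast; ring),
    output_single (i := 0) (j := 0) q.zero_le q.zero_le (by simp), delta, add_mul,
    mono_mul_mono, mono_mul_mono, ← mono_zero]
  norm_num
  ring

theorem output_seed_one (hq : 1 ≤ q) : output q (seed q 1) = mono (-1) 0 := by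
  rw [seed, output_single (i := 0) (j := 1) q.zero_le hq (by simp), Nat.cast_zero, Nat.cast_one,
    zero_sub, sub_self]

theorem output_seed_add_two (hn : n + 2 ≤ q) : output q (seed q (n + 2)) = mono (n + 1) 1 := by
  rw [seed, output_single (i := n + 2) (j := 2) hn (by omega) (by push_cast; ring)]
  congr 1
  push_cast
  ring

theorem output_torusArray (hq : 2 ≤ q) (hn : n ≤ q) :
    output q (torusArray q n) = torusPolynomial n := by
  induction n using Nat.twoStepInduction with
  | zero => rw [torusArray, output_seed_zero hq, torusPolynomial]
  | one => rw [torusArray, output_seed_one (by omega), torusPolynomial]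
  | more n ih₀ ih₁ =>
    rw [torusArray, output_sub, output_add, output_seed_add_two hn, output_shift fun i =>
        torusArray_eq_zero_of_lt_column (by push_cast; omega) (by omega) le_rfl,
      ih₀ (by omega), ih₁ (by omega), torusPolynomial]
    ring

end TorusArray

/-! ### Registers and the array -/

/-- Names for finitely many memory cells at negative addresses. The cells at nonnegative addresses
are used as one array. -/
inductive Register where
  | zero | one | size | side | area | block | back | twice | counter | pointer | value | operand
  deriving DecidableEq

/-- The address of a register. -/
def Register.cell : Register → ℤ
  | zero => -1
  | one => -2
  | size => -3
  | side => -4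
  | area => -5
  | block => -6
  | back => -7
  | twice => -8
  | counter => -9
  | pointer => -10
  | value => -11
  | operand => -12

instance : Coe Register ℤ := ⟨Register.cell⟩

theorem Register.cell_injective : Function.Injective Register.cell := by
  intro r s h
  cases r <;> cases s <;> first | rfl | cases h

theorem Register.cell_neg (r : Register) : r.cell < 0 := by
  cases r <;> decide

/-- The memory `m` holds the values `ρ` in the registers and `A` in the array. -/
def Represents (m : ℤ → ℤ) (ρ : Register → ℤ) (A : ℤ → ℤ) : Prop :=
  (∀ r : Register, m r = ρ r) ∧ ∀ x, 0 ≤ x → m x = A x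

/-- Started with registers `ρ` and array `A`, the program `p` halts after at most `B` steps with
registers and array that satisfy `Q`. -/
def Reaches (p : Program) (B : ℕ) (ρ : Register → ℤ) (A : ℤ → ℤ)
    (Q : (Register → ℤ) → (ℤ → ℤ) → Prop) : Prop :=
  ∀ m, Represents m ρ A → ∃ m' t, Runs p m m' t ∧ t ≤ B ∧ ∃ ρ' A', Represents m' ρ' A' ∧ Q ρ' A'

section Machine

variable {m : ℤ → ℤ} {ρ : Register → ℤ} {A : ℤ → ℤ} {Q : (Register → ℤ) → (ℤ → ℤ) → Prop}
  {p p' : Program} {B B' : ℕ}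

theorem Represents.update_register (h : Represents m ρ A) (r : Register) (v : ℤ) :
    Represents (Function.update m r v) (Function.update ρ r v) A := by
  refine ⟨fun s => ?_, fun x hx => ?_⟩
  · simp only [Function.update_apply, Register.cell_injective.eq_iff, h.1]
  · rw [Function.update_of_ne (r.cell_neg.trans_le hx).ne', h.2 x hx]

theorem Represents.update_array (h : Represents m ρ A) {x : ℤ} (hx : 0 ≤ x) (v : ℤ) :
    Represents (Function.update m x v) ρ (Function.update A x v) := by
  refine ⟨fun s => ?_, fun y hy => ?_⟩
  · rw [Function.update_of_ne (s.cell_neg.trans_le hx).ne, h.1]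
  · simp only [Function.update_apply, h.2 y hy]

theorem Reaches.const {r : Register} {c : ℤ} (h : Q (Function.update ρ r c) A) :
    Reaches (.const r c) 1 ρ A Q :=
  fun m hm => ⟨_, _, .const r c m, le_rfl, _, _, hm.update_register r c, h⟩

theorem Reaches.add {r s s' : Register} {v : ℤ} (hv : ρ s + ρ s' = v)
    (h : Q (Function.update ρ r v) A) : Reaches (.add r s s') 1 ρ A Q := fun m hm => by
  rw [← hv, ← hm.1, ← hm.1] at h
  exact ⟨_, _, .add r s s' m, le_rfl, _, _, hm.update_register r _, h⟩

theorem Reaches.sub {r s s' : Register} {v : ℤ} (hv : ρ s - ρ s' = v)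
    (h : Q (Function.update ρ r v) A) : Reaches (.sub r s s') 1 ρ A Q := fun m hm => by
  rw [← hv, ← hm.1, ← hm.1] at h
  exact ⟨_, _, .sub r s s' m, le_rfl, _, _, hm.update_register r _, h⟩

theorem Reaches.load {r s : Register} {x : ℤ} (hs : ρ s = x) (hx : 0 ≤ x)
    (h : Q (Function.update ρ r (A x)) A) : Reaches (.load r s) 1 ρ A Q := fun m hm => by
  rw [← hm.2 x hx, ← hs, ← hm.1] at h
  exact ⟨_, _, .load r s m, le_rfl, _, _, hm.update_register r _, h⟩

theorem Reaches.store {r s : Register} {x v : ℤ} (hr : ρ r = x) (hs : ρ s = v) (hx : 0 ≤ x)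
    (h : Q ρ (Function.update A x v)) : Reaches (.store r s) 1 ρ A Q := fun m hm => by
  have result := hm.update_array hx v
  rw [← hr, ← hs, ← hm.1, ← hm.1] at result
  rw [← hr, ← hs, ← hm.1, ← hm.1] at h
  exact ⟨_, _, .store r s m, le_rfl, _, _, result, h⟩

theorem Reaches.seq (h : Reaches p B ρ A fun ρ' A' => Reaches p' B' ρ' A' Q) :
    Reaches (.seq p p') (B' + B) ρ A Q := by
  intro m hm
  obtain ⟨m₁, t₁, run₁, ht₁, ρ₁, A₁, hm₁, h₁⟩ := h m hm
  obtain ⟨m₂, t₂, run₂, ht₂, post⟩ := h₁ m₁ hm₁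
  exact ⟨m₂, _, .seq run₁ run₂, by omega, post⟩

theorem Reaches.of_le (h : Reaches p B ρ A Q) (hB : B ≤ B') : Reaches p B' ρ A Q := by
  intro m hm
  obtain ⟨m', t, run, ht, post⟩ := h m hm
  exact ⟨m', t, run, ht.trans hB, post⟩

theorem Reaches.imp {Q' : (Register → ℤ) → (ℤ → ℤ) → Prop} (h : Reaches p B ρ A Q)
    (hQ : ∀ ρ' A', Q ρ' A' → Q' ρ' A') : Reaches p B ρ A Q' := by
  intro m hm
  obtain ⟨m', t, run, ht, ρ', A', hm', h'⟩ := h m hm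
  exact ⟨m', t, run, ht, ρ', A', hm', hQ ρ' A' h'⟩

theorem Reaches.whilePos {r : Register} (I : ℕ → (Register → ℤ) → (ℤ → ℤ) → Prop)
    (counter : ∀ k ρ A, I k ρ A → ρ r = k)
    (body : ∀ k ρ A, I (k + 1) ρ A → Reaches p B ρ A (I k)) (k : ℕ) (start : I k ρ A) :
    Reaches (.whilePos r p) ((B + 1) * k + 1) ρ A (I 0) := by
  induction k generalizing ρ A with
  | zero =>
    intro m hm
    have halt : m r ≤ 0 := by rw [hm.1, counter 0 ρ A start, Nat.cast_zero]
    exact ⟨m, 1, .while_false halt, by omega, ρ, A, hm, start⟩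
  | succ k ih =>
    intro m hm
    have positive : 0 < m r := by
      rw [hm.1, counter _ ρ A start]
      exact Int.natCast_pos.2 k.succ_pos
    obtain ⟨m₁, t₁, run₁, ht₁, ρ₁, A₁, hm₁, h₁⟩ := body k ρ A start m hm
    obtain ⟨m₂, t₂, run₂, ht₂, post⟩ := ih h₁ m₁ hm₁
    exact ⟨m₂, _, .while_true positive run₁ run₂, by rw [mul_add_one]; omega, post⟩

end Machine

theorem represents_input (q : ℕ) : Represents (input q) 0 (Pi.single 0 (q : ℤ)) :=
  ⟨fun r => Function.update_of_ne r.cell_neg.ne _ _, fun _ _ => rfl⟩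

/-! ### The program -/

section Program

open Register

/-- The number of cells reserved for one coefficient array: one row more than `output` reads. -/
def blockSize (q : ℕ) : ℤ := (q + 1) * (q + 1) + (q + 1)

/-- The address of the entry number `y` of the coefficient array of `torusPolynomial n`. The arrays
are stored in the order of decreasing `n`, so that the last one is where `output` expects it. -/
def address (q n : ℕ) (y : ℤ) : ℤ := (q - n) * blockSize q + y

/-- The array `A` consists of the blocks `R q, …, R 0`. -/
def Stores (q : ℕ) (A : ℤ → ℤ) (R : ℕ → ℤ → ℤ) : Prop :=
  ∀ n ≤ q, ∀ y, 0 ≤ y → y < blockSize q → A (address q n y) = R n y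

/-- The registers that are constant after `setUp`. -/
def Layout (q : ℕ) (ρ : Register → ℤ) : Prop :=
  ρ zero = 0 ∧ ρ one = 1 ∧ ρ size = q ∧ ρ side = q + 1 ∧ ρ area = (q + 1) * (q + 1) ∧
    ρ block = blockSize q ∧ ρ back = blockSize q - 1 ∧ ρ twice = 2 * blockSize q

/-- One round of the repeated addition in `setUp`. -/
def squareStep : Program :=
  .seq (.add area area side)
  (.sub counter counter one)

/-- Clears the input cell and sets the registers of `Layout`; the square is a repeated addition. -/
def setUp : Program :=
  .seq (.load size zero) <|
  .seq (.store zero zero) <|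
  .seq (.const one 1) <|
  .seq (.add side size one) <|
  .seq (.add counter side zero) <|
  .seq (.whilePos counter squareStep) <|
  .seq (.add block area side) <|
  .seq (.sub back block one)
  (.add twice block block)

/-- Writes one array `seed q n` with `2 ≤ n` and moves on to the next block. -/
def writeHighSeed : Program :=
  .seq (.store pointer one) <|
  .seq (.add pointer pointer area)
  (.sub counter counter one)

/-- Writes `seed q n` for `n = q, …, 2`. -/
def writeHighSeeds : Program :=
  .seq (.sub counter size one) <|
  .seq (.sub pointer area side) <|
  .seq (.add pointer pointer one) <|
  .seq (.add pointer pointer one)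
  (.whilePos counter writeHighSeed)

/-- Writes `seed q 1` and `seed q 0` and prepares the counter for `applyRecursion`. -/
def writeLowSeeds : Program :=
  .seq (.sub pointer pointer side) <|
  .seq (.sub pointer pointer one) <|
  .seq (.store pointer one) <|
  .seq (.sub counter pointer one) <|
  .seq (.add pointer counter block) <|
  .seq (.store pointer one) <|
  .seq (.add pointer pointer side) <|
  .seq (.add pointer pointer one) <|
  .seq (.sub value zero one) <|
  .seq (.store pointer value) <|
  .seq (.add pointer pointer side) <|
  .seq (.sub pointer pointer one)
  (.store pointer one)

/-- Adds the recursion of `torusArray` to the entry in the cell before `counter`: the entry of the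
preceding array with the index lowered by one stands `back` cells further, and the entry of the
array before that one stands `twice` cells further. -/
def recursionStep : Program :=
  .seq (.sub counter counter one) <|
  .seq (.add pointer counter back) <|
  .seq (.load value pointer) <|
  .seq (.add pointer counter twice) <|
  .seq (.load operand pointer) <|
  .seq (.sub value value operand) <|
  .seq (.load operand counter) <|
  .seq (.add value value operand)
  (.store counter value)

/-- Adds the recursion of `torusArray` to the seeds, from the last entry of array number `2` down to
the first entry of array number `q`. -/
def applyRecursion : Program := .whilePos counter recursionStep

/-- The program that computes the coefficients of `torusPolynomial`. -/
def torusProgram : Program :=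
  .seq setUp <| .seq writeHighSeeds <| .seq writeLowSeeds applyRecursion

variable {q : ℕ} {ρ : Register → ℤ} {A : ℤ → ℤ}

/-- The state in which `k` rounds of the loop of `setUp` are left. -/
def SquareSummed (q k : ℕ) (ρ : Register → ℤ) (A : ℤ → ℤ) : Prop :=
  ρ zero = 0 ∧ ρ one = 1 ∧ ρ size = q ∧ ρ side = q + 1 ∧ ρ area = (q + 1 - k) * (q + 1) ∧
    ρ counter = k ∧ A = 0

theorem SquareSummed.squareStep_reaches {k : ℕ} (h : SquareSummed q (k + 1) ρ A) :
    Reaches squareStep 2 ρ A (SquareSummed q k) := by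
  obtain ⟨hzero, hone, hsize, hside, harea, hcounter, hA⟩ := h
  have harea' : ρ area + ρ side = (q + 1 - k) * (q + 1) := by
    rw [harea, hside]
    push_cast
    ring
  have hcounter' : ρ counter - ρ one = k := by
    rw [hcounter, hone, Nat.cast_succ, add_sub_cancel_right]
  exact .of_le (.seq <| .add harea' <| .sub hcounter'
    ⟨hzero, hone, hsize, hside, rfl, rfl, hA⟩) le_rfl

theorem SquareSummed.layout_reaches (h : SquareSummed q 0 ρ A) :
    Reaches (.seq (.add block area side) <| .seq (.sub back block one) (.add twice block block))
      3 ρ A fun ρ A => Layout q ρ ∧ A = 0 := by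
  obtain ⟨hzero, hone, hsize, hside, harea, -, hA⟩ := h
  rw [Nat.cast_zero, sub_zero] at harea
  have hblock : ρ area + ρ side = blockSize q := by rw [harea, hside, blockSize]
  have hback : blockSize q - ρ one = blockSize q - 1 := by rw [hone]
  exact .of_le (.seq <| .add hblock <| .seq <| .sub hback <| .add (two_mul _).symm
    ⟨⟨hzero, hone, hsize, hside, harea, rfl, rfl, rfl⟩, hA⟩) le_rfl

theorem setUp_reaches (q : ℕ) : Reaches setUp (3 * q + 12) 0 (Pi.single 0 (q : ℤ))
    fun ρ A => Layout q ρ ∧ A = 0 := by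
  have harea : (0 : ℤ) = (q + 1 - (q + 1 : ℕ)) * (q + 1) := by
    rw [Nat.cast_succ, sub_self, zero_mul]
  have cleared : Function.update (Pi.single 0 (q : ℤ)) 0 0 = (0 : ℤ → ℤ) :=
    (Function.update_idem _ _ _).trans (Function.update_eq_self (0 : ℤ) (0 : ℤ → ℤ))
  exact .of_le (.seq <| .load rfl le_rfl <| .seq <| .store rfl rfl le_rfl <| .seq <| .const <|
    .seq <| .add rfl <| .seq <| .add (add_zero _) <| .seq <|
    .imp (.whilePos (SquareSummed q) (fun _ _ _ h => h.2.2.2.2.2.1)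
      (fun _ _ _ h => h.squareStep_reaches) (q + 1)
      ⟨rfl, rfl, rfl, rfl, harea, rfl, cleared⟩) fun _ _ h => h.layout_reaches) (by omega)

theorem address_nonneg {n : ℕ} (hn : n ≤ q) {y : ℤ} (hy : 0 ≤ y) : 0 ≤ address q n y := by
  have : (0 : ℤ) ≤ q - n := by omega
  rw [address, blockSize]
  positivity

theorem address_inj {n n' : ℕ} {y y' : ℤ} (hy : 0 ≤ y) (hyq : y < blockSize q) (hy' : 0 ≤ y')
    (hyq' : y' < blockSize q) : address q n y = address q n' y' ↔ n = n' ∧ y = y' := by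
  rw [address, address, mul_add_inj hy hyq hy' hyq', sub_right_inj, Nat.cast_inj]

theorem Stores.update {R : ℕ → ℤ → ℤ} (h : Stores q A R) (n : ℕ) {y : ℤ} (hy : 0 ≤ y)
    (hyq : y < blockSize q) (v : ℤ) : Stores q (Function.update A (address q n y) v)
      (Function.update R n (Function.update (R n) y v)) := by
  intro n' hn' y' hy' hyq'
  rw [Function.update_apply, h n' hn' y' hy' hyq']
  simp only [address_inj hy' hyq' hy hyq]
  obtain rfl | hne := eq_or_ne n' n
  · simp only [true_and, Function.update_self, Function.update_apply]
  · rw [if_neg fun h => hne h.1, Function.update_of_ne hne]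

/-- The state in which the seeds of the numbers greater than `k + 1` have been written and
`pointer` is prepared for the next one. -/
def HighSeedsStored (q k : ℕ) (ρ : Register → ℤ) (A : ℤ → ℤ) : Prop :=
  Layout q ρ ∧ ρ counter = k ∧ ρ pointer = address q (k + 1) ((k + 1 : ℕ) * (q + 1) + 2) ∧
    Stores q A fun n => if k + 1 < n then seed q n else 0

theorem HighSeedsStored.writeHighSeed_reaches {k : ℕ} (hk : k + 2 ≤ q)
    (h : HighSeedsStored q (k + 1) ρ A) :
    Reaches writeHighSeed 3 ρ A (HighSeedsStored q k) := by
  obtain ⟨⟨hzero, hone, hsize, hside, harea, hlayout⟩, hcounter, hpointer, hA⟩ := h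
  have inBlock : ((k + 1 + 1 : ℕ) : ℤ) * (q + 1) + 2 < blockSize q := by
    have : ((k + 1 + 1 : ℕ) : ℤ) * (q + 1) ≤ q * (q + 1) := by gcongr
    rw [blockSize]
    linarith
  have hpointer' : ρ pointer + ρ area = address q (k + 1) ((k + 1 : ℕ) * (q + 1) + 2) := by
    rw [hpointer, harea, address, address, blockSize]
    push_cast
    ring
  have hcounter' : ρ counter - ρ one = k := by
    rw [hcounter, hone, Nat.cast_succ, add_sub_cancel_right]
  refine .of_le (.seq <| .store hpointer hone (address_nonneg hk (by positivity)) <| .seq <|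
    .add hpointer' <| .sub hcounter'
      ⟨⟨hzero, hone, hsize, hside, harea, hlayout⟩, rfl, rfl, ?_⟩) le_rfl
  convert hA.update (k + 2) (by positivity) inBlock 1 using 1
  funext n
  obtain rfl | hne := eq_or_ne n (k + 2)
  · rw [Function.update_self, if_pos (by omega), if_neg (by omega), seed]
    push_cast
    rw [Pi.single, add_assoc (k : ℤ), one_add_one_eq_two]
  · rw [Function.update_of_ne hne]
    simp only [show k + 1 + 1 < n ↔ k + 1 < n by omega]

theorem writeHighSeeds_reaches (hq : 2 ≤ q) (h : Layout q ρ ∧ A = 0) :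
    Reaches writeHighSeeds (4 * q + 1) ρ A (HighSeedsStored q 0) := by
  obtain ⟨⟨hzero, hone, hsize, hside, harea, hlayout⟩, rfl⟩ := h
  have hcounter : ρ size - ρ one = (q - 1 : ℕ) := by
    rw [hsize, hone, Nat.cast_sub (by omega), Nat.cast_one]
  have hpointer : ρ area - ρ side + ρ one + ρ one =
      address q (q - 1 + 1) ((q - 1 + 1 : ℕ) * (q + 1) + 2) := by
    rw [harea, hside, hone, Nat.sub_add_cancel (by omega), address]
    ring
  have empty : Stores q 0 fun n => if q - 1 + 1 < n then seed q n else 0 := fun n hn y _ _ => by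
    simp only [if_neg (show ¬ q - 1 + 1 < n by omega), Pi.zero_apply]
  exact .of_le (.seq <| .sub hcounter <| .seq <| .sub rfl <| .seq <| .add rfl <| .seq <|
    .add hpointer <|
    .imp (.whilePos (fun k ρ A => k + 1 ≤ q ∧ HighSeedsStored q k ρ A) (fun k ρ A h => h.2.2.1)
      (fun k ρ A h => (h.2.writeHighSeed_reaches h.1).imp fun _ _ h' => ⟨by omega, h'⟩) (q - 1)
      ⟨by omega, ⟨hzero, hone, hsize, hside, harea, hlayout⟩, rfl, rfl, empty⟩)
      fun ρ A h => h.2) (by omega)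

theorem seed_zero_eq_update (hq : 1 ≤ q) : seed q 0 = Function.update (Function.update
    (Function.update (0 : ℤ → ℤ) 0 1) (q + 2) (-1)) (2 * (q + 1)) 1 := by
  funext x
  simp only [seed, Pi.add_apply, Pi.sub_apply, Pi.single_apply, Function.update_apply,
    Pi.zero_apply]
  split_ifs <;> omega

theorem Stores.lowSeeds (hq : 2 ≤ q) (h : Stores q A fun n => if 1 < n then seed q n else 0) :
    Stores q (Function.update (Function.update (Function.update
      (Function.update A (address q 1 1) 1) (address q 0 0) 1) (address q 0 (q + 2)) (-1))
      (address q 0 (2 * (q + 1))) 1) (seed q) := by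
  have inBlock : 2 * ((q : ℤ) + 1) < blockSize q := by rw [blockSize]; nlinarith
  convert (((h.update 1 zero_le_one (by omega) 1).update 0 le_rfl (by omega) 1).update 0
    (by omega) (by omega : (q : ℤ) + 2 < blockSize q) (-1)).update 0 (by omega) inBlock 1 using 1
  funext n
  match n with
  | 0 => simp only [Function.update_self, Function.update_of_ne, ne_eq, zero_ne_one,
      not_false_eq_true, not_lt_zero, if_false, seed_zero_eq_update (show 1 ≤ q by omega)]
  | 1 => simp only [Function.update_self, Function.update_of_ne, ne_eq, one_ne_zero,
      not_false_eq_true, lt_irrefl, if_false, seed, Pi.single]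
  | n + 2 => rw [Function.update_of_ne (by omega), Function.update_of_ne (by omega),
      Function.update_of_ne (by omega), Function.update_of_ne (by omega), if_pos (by omega)]

theorem writeLowSeeds_reaches (hq : 2 ≤ q) (h : HighSeedsStored q 0 ρ A) :
    Reaches writeLowSeeds 13 ρ A fun ρ A =>
      Layout q ρ ∧ ρ counter = (q - 1) * blockSize q ∧ Stores q A (seed q) := by
  obtain ⟨⟨hzero, hone, hsize, hside, harea, hblock, hlayout⟩, -, hpointer, hA⟩ := h
  have h₁ : ρ pointer - ρ side = address q 1 2 := by rw [hpointer, hside, address, address]; ring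
  have h₂ : address q 1 2 - ρ one = address q 1 1 := by rw [hone, address, address]; ring
  have h₃ : address q 1 1 - ρ one = (q - 1) * blockSize q := by rw [hone, address]; ring
  have h₄ : (q - 1) * blockSize q + ρ block = address q 0 0 := by rw [hblock, address]; ring
  have h₅ : address q 0 0 + ρ side = address q 0 (q + 1) := by rw [hside, address, address]; ring
  have h₆ : address q 0 (q + 1) + ρ one = address q 0 (q + 2) := by
    rw [hone, address, address]; ring
  have h₇ : ρ zero - ρ one = -1 := by rw [hzero, hone]; rfl
  have h₈ : address q 0 (q + 2) + ρ side = address q 0 (2 * (q + 1) + 1) := by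
    rw [hside, address, address]; ring
  have h₉ : address q 0 (2 * (q + 1) + 1) - ρ one = address q 0 (2 * (q + 1)) := by
    rw [hone, address, address]; ring
  exact .of_le (.seq <| .sub h₁ <| .seq <| .sub h₂ <| .seq <|
    .store rfl hone (address_nonneg (by omega) zero_le_one) <| .seq <| .sub h₃ <| .seq <|
    .add h₄ <| .seq <| .store rfl hone (address_nonneg (by omega) le_rfl) <| .seq <|
    .add h₅ <| .seq <| .add h₆ <| .seq <| .sub h₇ <| .seq <|
    .store rfl rfl (address_nonneg (by omega) (by omega)) <| .seq <| .add h₈ <| .seq <|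
    .sub h₉ <| .store rfl hone (address_nonneg (by omega) (by omega))
      ⟨⟨hzero, hone, hsize, hside, harea, hblock, hlayout⟩, rfl, hA.lowSeeds hq⟩) le_rfl

/-- The array `A` arises from `A₀` by applying the recursion to the cells from `k` on, up to the
last cell of block number `2`. -/
def RecursionApplied (q : ℕ) (A₀ : ℤ → ℤ) (k : ℕ) (A : ℤ → ℤ) : Prop :=
  ∀ x, 0 ≤ x → A x = if k ≤ x ∧ x < (q - 1) * blockSize q then
    A₀ x + A (x + (blockSize q - 1)) - A (x + 2 * blockSize q) else A₀ x

section RecursionApplied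

variable {A₀ : ℤ → ℤ} {R : ℕ → ℤ → ℤ} {k n : ℕ} {y : ℤ}

theorem one_lt_blockSize (hq : 1 ≤ q) : 1 < blockSize q := by
  rw [blockSize]
  nlinarith

theorem RecursionApplied.update (hq : 1 ≤ q) (hk : k < (q - 1) * blockSize q)
    (h : RecursionApplied q A₀ (k + 1) A) : RecursionApplied q A₀ k (Function.update A k
      (A (k + (blockSize q - 1)) - A (k + 2 * blockSize q) + A k)) := by
  have hsize := one_lt_blockSize hq
  intro x hx
  obtain hlt | rfl | hgt := lt_trichotomy x k
  · rw [if_neg (by omega), Function.update_of_ne hlt.ne, h x hx, if_neg (by omega)]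
  · rw [if_pos ⟨le_rfl, hk⟩, Function.update_self, Function.update_of_ne (by omega),
      Function.update_of_ne (by omega), h k hx, if_neg (by omega)]
    ring
  · rw [Function.update_of_ne hgt.ne', Function.update_of_ne (by omega),
      Function.update_of_ne (by omega), h x hx]
    simp only [show ((k + 1 : ℕ) : ℤ) ≤ x ↔ (k : ℤ) ≤ x by omega]

theorem recursionStep_reaches (hq : 1 ≤ q) (hk : k < (q - 1) * blockSize q) (hρ : Layout q ρ)
    (hcounter : ρ counter = (k + 1 : ℕ)) (h : RecursionApplied q A₀ (k + 1) A) :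
    Reaches recursionStep 9 ρ A fun ρ A =>
      Layout q ρ ∧ ρ counter = k ∧ RecursionApplied q A₀ k A := by
  obtain ⟨hzero, hone, hsize, hside, harea, hblock, hback, htwice⟩ := hρ
  have hcounter' : ρ counter - ρ one = k := by
    rw [hcounter, hone, Nat.cast_succ, add_sub_cancel_right]
  have hpointer : k + ρ back = k + (blockSize q - 1) := by rw [hback]
  have hpointer' : k + ρ twice = k + 2 * blockSize q := by rw [htwice]
  have := one_lt_blockSize hq
  exact .of_le (.seq <| .sub hcounter' <| .seq <| .add hpointer <| .seq <|
    .load (x := k + (blockSize q - 1)) rfl (by omega) <| .seq <| .add hpointer' <| .seq <|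
    .load (x := k + 2 * blockSize q) rfl (by omega) <| .seq <| .sub rfl <| .seq <|
    .load (x := k) rfl (by omega) <| .seq <| .add rfl <| .store (x := k) rfl rfl (by omega)
      ⟨⟨hzero, hone, hsize, hside, harea, hblock, hback, htwice⟩, rfl, h.update hq hk⟩) le_rfl

theorem applyRecursion_reaches (hq : 1 ≤ q) (hk : k = (q - 1) * blockSize q) (hρ : Layout q ρ)
    (hcounter : ρ counter = k) :
    Reaches applyRecursion (10 * k + 1) ρ A fun _ A' => RecursionApplied q A 0 A' := by
  have start : RecursionApplied q A k A := fun x _ => by rw [if_neg (by omega)]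
  exact (Reaches.whilePos (fun k' ρ A' => k' ≤ k ∧ Layout q ρ ∧ ρ counter = k' ∧
      RecursionApplied q A k' A') (fun _ _ _ h => h.2.2.1)
    (fun k' ρ A ⟨_, hρ, hcounter, h⟩ => (recursionStep_reaches hq (by omega) hρ hcounter h).imp
      fun _ _ h' => ⟨by omega, h'⟩) k ⟨le_rfl, hρ, hcounter, start⟩).imp fun _ _ h => h.2.2.2

theorem RecursionApplied.apply_address_of_le_one
    (h : RecursionApplied q A₀ 0 A) (h₀ : Stores q A₀ R) (hn : n ≤ 1) (hnq : n ≤ q)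
    (hy : 0 ≤ y) (hyq : y < blockSize q) : A (address q n y) = R n y := by
  have : (q - 1) * blockSize q ≤ address q n y := by
    rw [address]
    nlinarith
  rw [h _ (address_nonneg hnq hy), if_neg (by omega), h₀ n hnq y hy hyq]

theorem RecursionApplied.apply_address_add_two
    (h : RecursionApplied q A₀ 0 A) (h₀ : Stores q A₀ R) (hn : n + 2 ≤ q)
    (hy : 0 ≤ y) (hyq : y < blockSize q) : A (address q (n + 2) y) =
      R (n + 2) y + A (address q (n + 1) (y - 1)) - A (address q n y) := by
  have inRange : address q (n + 2) y < (q - 1) * blockSize q := by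
    rw [address]
    push_cast
    nlinarith
  have previous : address q (n + 2) y + (blockSize q - 1) = address q (n + 1) (y - 1) := by
    rw [address, address]
    push_cast
    ring
  have beforePrevious : address q (n + 2) y + 2 * blockSize q = address q n y := by
    rw [address, address]
    push_cast
    ring
  rw [h _ (address_nonneg hn hy), if_pos ⟨address_nonneg hn hy, inRange⟩, h₀ _ hn y hy hyq,
    previous, beforePrevious]

theorem RecursionApplied.stores_torusArray (hq : 2 ≤ q)
    (h : RecursionApplied q A₀ 0 A) (h₀ : Stores q A₀ (seed q)) : Stores q A (torusArray q) := by
  intro n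
  induction n using Nat.twoStepInduction with
  | zero =>
    intro hn y hy hyq
    rw [h.apply_address_of_le_one h₀ zero_le_one hn hy hyq, torusArray]
  | one =>
    intro hn y hy hyq
    rw [h.apply_address_of_le_one h₀ le_rfl hn hy hyq, torusArray]
  | more n ih₀ ih₁ =>
    intro hn y hy hyq
    have recursion {y : ℤ} (hy : 0 ≤ y) (hyq : y < blockSize q) :=
      h.apply_address_add_two h₀ hn hy hyq
    have ofPos {y : ℤ} (hy : 0 < y) (hyq : y < blockSize q) :
        A (address q (n + 2) y) = torusArray q (n + 2) y := by
      rw [recursion hy.le hyq, ih₀ (by omega) y hy.le hyq, ih₁ (by omega) _ (by omega) (by omega)]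
      rfl
    obtain rfl | hy := hy.eq_or_lt
    · -- The index `-1` leads to the last cell of the block itself, where the array vanishes too.
      have hsize : blockSize q = q * (q + 1) + 2 * q + 2 := by rw [blockSize]; ring
      have previous : A (address q (n + 1) (0 - 1)) = torusArray q (n + 1) (-1 * (q + 1) + q) := by
        have last : address q (n + 1) (0 - 1) = address q (n + 2) (blockSize q - 1) := by
          rw [address, address]; push_cast; ring
        rw [last, ofPos (by nlinarith) (by omega),
          torusArray_eq_zero_of_gt hq hn (by push_cast; omega),
          torusArray_eq_zero_of_lt_column (by push_cast; omega) (by omega) le_rfl]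
      rw [recursion le_rfl hyq, ih₀ (by omega) 0 le_rfl hyq, previous]
      simp [torusArray]
    · exact ofPos hy hyq

end RecursionApplied

theorem torusProgram_reaches (hq : 2 ≤ q) : Reaches torusProgram (20 * (q + 1) ^ 3) 0
    (Pi.single 0 (q : ℤ)) fun _ A => Stores q A (torusArray q) := by
  obtain ⟨k, hk⟩ : ∃ k : ℕ, (k : ℤ) = (q - 1) * blockSize q :=
    ⟨(q - 1) * ((q + 1) * (q + 1) + (q + 1)), by
      rw [blockSize, Nat.cast_mul, Nat.cast_sub (by omega)]; push_cast; ring⟩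
  refine .of_le (.seq <| (setUp_reaches q).imp fun _ _ h => .seq <|
    (writeHighSeeds_reaches hq h).imp fun _ _ h => .seq <|
    (writeLowSeeds_reaches hq h).imp fun _ _ h =>
    (applyRecursion_reaches (by omega) hk h.1 (h.2.1.trans hk.symm)).imp fun _ _ h' =>
      h'.stores_torusArray hq h.2.2) ?_
  have : k + 2 * (q + 1) ≤ (q + 1) ^ 3 := by
    rw [blockSize] at hk
    zify
    rw [hk]
    nlinarith
  nlinarith

theorem exists_runs_torusProgram (hq : 2 ≤ q) : ∃ m t, Runs torusProgram (input q) m t ∧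
    t ≤ 20 * (q + 1) ^ 3 ∧ output q m = torusPolynomial q := by
  obtain ⟨m, t, run, ht, ρ, A, hm, hA⟩ := torusProgram_reaches hq _ (represents_input q)
  refine ⟨m, t, run, ht, ?_⟩
  rw [← output_torusArray hq le_rfl]
  refine output_congr fun x hx hxq => ?_
  have last : address q q x = x := by rw [address, sub_self, zero_mul, zero_add]
  rw [hm.2 x hx, ← hA q le_rfl x hx (by rw [blockSize]; omega), last]

end Program

end KauffmanTorus

theorem mainTheorem4 :
    -- the recursive formula for `K(2,q)`
    (∀ q : ℕ, 2 ≤ q →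
      K (torusLink q) =
        (P q - ∑ i ∈ Finset.range (q - 1), P i * g (q - 2 - i)) • K unknot) ∧
    -- the same for every Laurent polynomial valued function obeying the rules for `K`
    (∀ F : LinkDiagram → Laurent, IsKauffmanPolynomial F → ∀ q : ℕ, 2 ≤ q →
      F (torusLink q) = P q - ∑ i ∈ Finset.range (q - 1), P i * g (q - 2 - i)) ∧
    -- the matching polynomial is a signed determinant of the balanced overlaid Tait graph
    (∀ q : ℕ, 1 ≤ q →
      ∃ (ε : Crossing (torusLink q).word → TaitFace (torusLink q).word 2 2 → ℤˣ)
        (e : Crossing (torusLink q).word ≃ TaitFace (torusLink q).word 2 2),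
        (Matrix.of fun v v' : Crossing (torusLink q).word =>
            (ε v (e v') : ℤ) • adjacencyMatrix (torusLink q).word 2 2 v (e v')).det =
          matchingPolynomial (torusLink q).word 2 2) ∧
    -- the coefficients of `K(2,q)` are computed in time polynomial in `q`
    (∃ (p : Program) (bound : Polynomial ℕ), ∀ q : ℕ, 2 ≤ q →
      ∃ (m : ℤ → ℤ) (t : ℕ), Runs p (input q) m t ∧ t ≤ bound.eval q ∧
        K (torusLink q) = output q m • K unknot ∧
        output q m = P q - ∑ i ∈ Finset.range (q - 1), P i * g (q - 2 - i)) := by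
  refine ⟨fun q hq => ?_, fun F hF q hq => ?_, fun q hq => ?_,
    torusProgram, 20 * (Polynomial.X + 1) ^ 3, fun q hq => ?_⟩
  · rw [K_torusLink, torusPolynomial_eq (by omega)]
  · rw [hF.eq_of_K_eq_smul (K_torusLink q), torusPolynomial_eq (by omega)]
  · obtain ⟨n, rfl⟩ := Nat.exists_eq_add_of_le' hq
    exact exists_det_eq_matchingPolynomial n
  · obtain ⟨m, t, run, ht, hm⟩ := exists_runs_torusProgram hq
    refine ⟨m, t, run, by simpa using ht, ?_, ?_⟩
    · rw [hm, K_torusLink]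
    · rw [hm, torusPolynomial_eq (by omega)]
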